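/- Let $D$ be a non-empty link diagram on $S^2$ (its projection may be disconnected). For $k\ge 0$ call $D$ *$k$-almost alternating* if it has a set of $k$ crossings, and no set of fewer than $k$ crossings, such that switching all the crossings of the set makes $D$ alternating; the crossings of such a set of size $k$ are called dealternators. Let $|s_AD|$ (resp. $|s_BD|$) be the number of circles obtained from $D$ by $A$-smoothing (resp. $B$-smoothing) every crossing. Let $D$ be $k$-almost alternating, and fix a set of $k$ dealternators. Define a compact surface $S$ with boundary and a graph $\Gamma_D\subset S$ by the following surgery on $S^2$. Around each dealternator take a small closed disc $O$, whose boundary meets the projection of $D$ transversely in four points $a,b,c,d$ (in counterclockwise order). Remove the interior of $O$ and glue on two bands $[0,1]\times[0,1]$: identify $\{0\}\times[0,1]$ and $\{1\}\times[0,1]$ of the first band with the arcs $ab$ and $dc$ of $\partial O$, and those of the second band with the arcs $bc$ and $ad$. The graph $\Gamma_D$ consists of the part of the projection of $D$ lying outside the discs $O$, together with the segments $[0,1]\times\{0\}$ and $[0,1]\times\{1\}$ of all the bands. Let $R_1,\dots,R_r$ be the connected components of $S\setminus\Gamma_D$, let $s_i$ be the rank of the first homology group $H_1(R_i;\mathbb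 Z)$, and put $s=s_1+\dots+s_r$. Then $$|s_AD|+|s_BD| = r+s .$$ -/

import Mathlib

universe u

noncomputable section

/-! ## Cell decompositions of closed oriented surfaces -/

/-- A finite cell decomposition of a closed oriented surface, given by its rotation system
(combinatorial map).  A dart is an edge together with a direction; it is attached to the vertex
from which it points away.  `rot` turns a dart counterclockwise to the next dart at the same
vertex, and `rev` reverses the direction of a dart. -/
structure CombMap where
  Dart : Type u
  [finite : Finite Dart]
  rot : Equiv.Perm Dart
  rev : Equiv.Perm Dart
  rev_rev : ∀ x, rev (rev x) = x
  rev_ne : ∀ x, rev x ≠ x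

attribute [instance] CombMap.finite

namespace CombMap

variable (M : CombMap.{u})

/-- Traversal of the face to the left of a dart: run along the dart to its end and take there the
next dart in clockwise order. -/
def facePerm : Equiv.Perm M.Dart := M.rot⁻¹ * M.rev

/-- Vertices are the cycles of `rot`. -/
abbrev Vertex : Type u := Quotient (Equiv.Perm.SameCycle.setoid M.rot)

/-- Edges are the cycles of `rev`. -/
abbrev Edge : Type u := Quotient (Equiv.Perm.SameCycle.setoid M.rev)

/-- Faces (open discs) are the cycles of `facePerm`. -/
abbrev Face : Type u := Quotient (Equiv.Perm.SameCycle.setoid M.facePerm)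

/-- The vertex from which a dart points away. -/
def vertexOf (x : M.Dart) : M.Vertex := Quotient.mk _ x

/-- The face to the left of a dart. -/
def faceOf (x : M.Dart) : M.Face := Quotient.mk _ x

theorem vertexOf_rot (x : M.Dart) : M.vertexOf (M.rot x) = M.vertexOf x :=
  Quotient.sound (Equiv.Perm.SameCycle.refl M.rot x).apply_left

theorem faceOf_facePerm (x : M.Dart) : M.faceOf (M.facePerm x) = M.faceOf x :=
  Quotient.sound (Equiv.Perm.SameCycle.refl M.facePerm x).apply_left

def eulerChar : ℤ := (Nat.card M.Vertex : ℤ) - Nat.card M.Edge + Nat.card M.Face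

/-- The surface is connected: any two darts are linked by rotations and reversals. -/
def IsConnected : Prop :=
  ∀ x y : M.Dart, Relation.EqvGen (fun a b => b = M.rot a ∨ b = M.rev a) x y

/-- The surface is the sphere `S²`. -/
def IsSphere : Prop := M.IsConnected ∧ M.eulerChar = 2

/-- The number of darts of `P` at the vertex of `x`. -/
def degIn (P : Set M.Dart) (x : M.Dart) : ℕ := {y | M.rot.SameCycle x y ∧ y ∈ P}.ncard

end CombMap

/-! ## Link diagrams -/

/-- A link diagram on `S²`, drawn in the 1-skeleton of a cell decomposition of `S²`.
The edges with darts in `proj` form the projection of the link.  A vertex on the projection is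
either a crossing (four darts, all on the projection, opposite ones belonging to the same strand)
or a point in the interior of a strand (exactly two of its darts are on the projection).
The other edges of the decomposition are arbitrary; they are there so that the projection may be
disconnected.  At a crossing, `overDarts` consists of the two opposite darts of the overcrossing
strand (away from the crossings `overDarts` is irrelevant). -/
structure LinkDiagram extends CombMap.{u} where
  isSphere : toCombMap.IsSphere
  proj : Set Dart
  rev_mem_proj : ∀ x ∈ proj, rev x ∈ proj
  valence : ∀ x ∈ proj, toCombMap.degIn proj x = 2 ∨
    (toCombMap.degIn proj x = 4 ∧ ∀ y, rot.SameCycle x y → y ∈ proj)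
  overDarts : Set Dart
  rot_mem_overDarts : ∀ x ∈ proj, toCombMap.degIn proj x = 4 → (rot x ∈ overDarts ↔ x ∉ overDarts)

namespace LinkDiagram

variable (D : LinkDiagram.{u})

/-- The dart `x` is one of the four darts at a crossing. -/
def AtCrossing (x : D.Dart) : Prop := x ∈ D.proj ∧ D.degIn D.proj x = 4

/-- The set of crossings. -/
def crossings : Set D.Vertex := D.vertexOf '' {x | D.AtCrossing x}

/-- `x` and `y` are the two darts of the projection at one interior point of a strand. -/
def Through (x y : D.Dart) : Prop :=
  x ∈ D.proj ∧ y ∈ D.proj ∧ ¬ D.AtCrossing x ∧ D.rot.SameCycle x y ∧ x ≠ y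

/-- `D.ArcEnd x y`: whoever leaves along `x` and follows the projection without passing through a
crossing can arrive at the vertex of `y`, through the edge of `y`. -/
inductive ArcEnd (D : LinkDiagram.{u}) : D.Dart → D.Dart → Prop
  | edge (x : D.Dart) : x ∈ D.proj → ArcEnd D x (D.rev x)
  | extend (x y z : D.Dart) : ArcEnd D x y → D.Through y z → ArcEnd D x (D.rev z)

/-- Along every component of the link, overpasses and underpasses alternate: of any two
consecutive passes through crossings, exactly one is over. -/
def IsAlternating : Prop :=
  ∀ x y, D.AtCrossing x → D.AtCrossing y → D.ArcEnd x y → (x ∈ D.overDarts ↔ y ∉ D.overDarts)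

/-- The diagram in which the crossings in `K` are switched. -/
def switch (K : Set D.Vertex) : LinkDiagram.{u} where
  toCombMap := D.toCombMap
  isSphere := D.isSphere
  proj := D.proj
  rev_mem_proj := D.rev_mem_proj
  valence := D.valence
  overDarts := {x | (D.vertexOf x ∈ K ∧ x ∉ D.overDarts) ∨ (D.vertexOf x ∉ K ∧ x ∈ D.overDarts)}
  rot_mem_overDarts := by
    intro x hx h4
    have h := D.rot_mem_overDarts x hx h4
    have hv := D.vertexOf_rot x
    simp only [Set.mem_ofPred_eq, hv]
    tauto

/-- `K` is a set of crossings such that switching them makes the diagram alternating. -/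
def IsDealternatorSet (K : Set D.Vertex) : Prop :=
  K ⊆ D.crossings ∧ (D.switch K).IsAlternating

/-- `D` is `k`-almost alternating: there is a set of `k` crossings, and none with less than `k`,
such that switching them makes the diagram alternating. -/
def IsAlmostAlternating (k : ℕ) : Prop :=
  (∃ K, D.IsDealternatorSet K ∧ K.ncard = k) ∧ ∀ K, D.IsDealternatorSet K → k ≤ K.ncard

/-- `A`-smoothing of a crossing.  The `A`-regions are those swept by the overcrossing strand
when it is turned counterclockwise; the smoothing joins them.  So an overcrossing dart gets
connected with the next dart in clockwise order. -/
def SmoothA (x y : D.Dart) : Prop := D.AtCrossing x ∧ x ∈ D.overDarts ∧ x = D.rot y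

/-- `B`-smoothing of a crossing: an overcrossing dart gets connected with the next dart in
counterclockwise order. -/
def SmoothB (x y : D.Dart) : Prop := D.AtCrossing x ∧ x ∈ D.overDarts ∧ y = D.rot x

/-- The circles of `s_A D`: the connected components of what the projection becomes when all
crossings are `A`-smoothed. -/
abbrev CircleA : Type u :=
  Quot fun x y : D.proj => y.1 = D.rev x.1 ∨ D.Through x.1 y.1 ∨ D.SmoothA x.1 y.1

/-- The circles of `s_B D`. -/
abbrev CircleB : Type u :=
  Quot fun x y : D.proj => y.1 = D.rev x.1 ∨ D.Through x.1 y.1 ∨ D.SmoothB x.1 y.1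

end LinkDiagram

/-! ## Surfaces with boundary, regions of the complement of a graph, homology -/

/-- A compact oriented surface with a graph on it: a cell decomposition of a closed
surface, the set of (open) faces that are removed, and the edges (as darts) of the graph, which is
meant to contain the boundary of the surface. -/
structure GraphSurface extends CombMap.{u} where
  hole : Set toCombMap.Face
  graph : Set Dart
  rev_mem_graph : ∀ x ∈ graph, rev x ∈ graph

namespace GraphSurface

variable (S : GraphSurface.{u})

/-- The faces of the surface (the removed ones excluded). -/
abbrev Polygon : Type u := {f : S.Face // f ∉ S.hole}

/-- The connected components of the complement of the graph: faces are joined across the edges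
that are not in the graph. (Around a vertex not on the graph this joins all faces.) -/
abbrev Region : Type u :=
  Quot fun f g : S.Polygon => ∃ x, x ∉ S.graph ∧ S.faceOf x = f.1 ∧ S.faceOf (S.rev x) = g.1

variable {S}

/- A region is made from polygons, the faces in it, by gluing them along the edges that are not in
the graph.  If the polygons are taken closed, this produces a compact surface with boundary whose
interior is the region, the inclusion being a homotopy equivalence.  The first homology
of the region is the cellular homology of this complex. -/

/-- The sides of the polygons in a region. A polygon lies to the left of its sides. -/
abbrev Side (R : S.Region) : Type u :=
  {x : S.Dart // ∃ h : S.faceOf x ∉ S.hole, (Quot.mk _ ⟨S.faceOf x, h⟩ : S.Region) = R}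

/-- The next side of the same polygon, in counterclockwise order. -/
def nextSide {R : S.Region} (x : Side R) : Side R :=
  ⟨S.facePerm x.1, by
    obtain ⟨h, hR⟩ := x.2
    have e : S.faceOf (S.facePerm x.1) = S.faceOf x.1 := S.faceOf_facePerm x.1
    exact ⟨e ▸ h, (congrArg (Quot.mk _) (Subtype.ext e)).trans hR⟩⟩

/-- The vertices after the gluing: the starting points of the sides, where the starting
point of `x` is identified with the starting point of the next dart in clockwise order (this is
the end of the side `rev x`) if `x` and `rev x` are glued. -/
abbrev Corner (R : S.Region) : Type u :=
  Quot fun x y : Side R => x.1 ∉ S.graph ∧ y.1 = S.rot⁻¹ x.1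

/-- The boundary of a 1-chain: a side is sent to its end minus its start. -/
def boundaryMap (R : S.Region) : (Side R →₀ ℤ) →ₗ[ℤ] (Corner R →₀ ℤ) :=
  Finsupp.linearCombination ℤ fun x =>
    Finsupp.single (Quot.mk _ (nextSide x)) 1 - Finsupp.single (Quot.mk _ x) 1

/-- The submodule of 1-chains that vanish in homology: it is generated by the boundaries of the
polygons and by the relations `x + rev x = 0` for any two sides `x` and `rev x` that are glued
to each other, the edge with its two directions. -/
def boundaries (R : S.Region) : Submodule ℤ (Side R →₀ ℤ) :=
  Submodule.span ℤ
    ({c | ∃ f : S.Face, c = ∑ᶠ x ∈ {x : Side R | S.faceOf x.1 = f}, Finsupp.single x 1} ∪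
     {c | ∃ x y : Side R, x.1 ∉ S.graph ∧ y.1 = S.rev x.1 ∧
        c = Finsupp.single x 1 + Finsupp.single y 1})

/-- The first homology group of a region, with integral coefficients. -/
abbrev H1 (R : S.Region) : Type u :=
  LinearMap.ker (boundaryMap R) ⧸ (boundaries R).submoduleOf (LinearMap.ker (boundaryMap R))

/-- The rank of the first homology group of a region. -/
def h1Rank (R : S.Region) : ℕ := Module.finrank ℤ (H1 R)

end GraphSurface

/-! ## The surface `S` and the graph `Γ_D` -/

namespace LinkDiagram

variable (D : LinkDiagram.{u})

/-- The darts at the vertices in `K`. -/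
abbrev DartAt (K : Set D.Vertex) : Type u := {x : D.Dart // D.vertexOf x ∈ K}

/-- Darts after the surgery.  For a dart `x` at a dealternator let `a x` be the point where it
leaves the small disc `O` around the dealternator; in counterclockwise order the points on the
boundary of `O` are `a x`, `a (rot x)`, `a (rot (rot x))`, …  From `a x` there start:
`old x`, the part of `x` outside of `O`;
`arcNext x` and `arcPrev x`, the arcs of the boundary of `O` to `a (rot x)` and `a (rot⁻¹ x)`;
`sideNext x` and `sidePrev x`, the sides of the bands to `a (rot x)` and `a (rot⁻¹ x)`. -/
inductive SurgeryDart (K : Set D.Vertex) : Type u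
  | old (x : D.Dart)
  | arcNext (x : D.DartAt K)
  | arcPrev (x : D.DartAt K)
  | sideNext (x : D.DartAt K)
  | sidePrev (x : D.DartAt K)

namespace SurgeryDart

variable {D} {K : Set D.Vertex}

/-- An encoding that shows that there are finitely many darts. -/
def code : D.SurgeryDart K → D.Dart × Fin 5
  | old x => (x, 0)
  | arcNext x => (x.1, 1)
  | arcPrev x => (x.1, 2)
  | sideNext x => (x.1, 3)
  | sidePrev x => (x.1, 4)

theorem code_injective : Function.Injective (code : D.SurgeryDart K → _) := by
  intro a b h
  cases a <;> cases b <;> simp [code] at h <;> first | exact congrArg _ h |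
    exact congrArg _ (Subtype.ext h)

instance : Finite (D.SurgeryDart K) := Finite.of_injective code code_injective

end SurgeryDart

/-- Rotation of the darts at the vertices in `K`. -/
def rotAt (K : Set D.Vertex) : Equiv.Perm (D.DartAt K) :=
  D.rot.subtypePerm fun x => by rw [D.vertexOf_rot x]

open Classical SurgeryDart in
/-- Rotation after the surgery.  The counterclockwise order of the darts at `a x` is `old x`,
`arcNext x`, `sidePrev x`, `sideNext x`, `arcPrev x`: between `arcNext x` and `sidePrev x` lies
the band which is glued to the arc from `a x` to `a (rot x)`, between `sideNext x` and
`arcPrev x` the other band, and the boundary component lies between `sidePrev x`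
and `sideNext x`. -/
def surgeryRot (K : Set D.Vertex) : Equiv.Perm (D.SurgeryDart K) where
  toFun
    | old x => if h : D.vertexOf x ∈ K then arcNext ⟨x, h⟩ else old (D.rot x)
    | arcNext x => sidePrev x
    | sidePrev x => sideNext x
    | sideNext x => arcPrev x
    | arcPrev x => old x.1
  invFun
    | old x => if h : D.vertexOf x ∈ K then arcPrev ⟨x, h⟩ else old (D.rot⁻¹ x)
    | arcNext x => old x.1
    | sidePrev x => arcNext x
    | sideNext x => sidePrev x
    | arcPrev x => sideNext x
  left_inv := by
    rintro (x | x | x | x | x)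
    · by_cases h : D.vertexOf x ∈ K
      · simp [h]
      · simp [h, D.vertexOf_rot x]
    all_goals first | rfl | exact dif_pos x.2
  right_inv := by
    rintro (x | x | x | x | x)
    · by_cases h : D.vertexOf x ∈ K
      · simp [h]
      · have h' : D.vertexOf (D.rot⁻¹ x) = D.vertexOf x := by
          have := D.vertexOf_rot (D.rot⁻¹ x)
          exact this.symm.trans (congrArg D.vertexOf (D.rot.apply_symm_apply x))
        have h'' : D.vertexOf (D.rot.symm x) ∉ K := fun hk => h (h' ▸ hk)
        simp [h, h'']
    all_goals first | rfl | exact dif_pos x.2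

open SurgeryDart in
/-- Reversal of the darts after the surgery. -/
def surgeryRev (K : Set D.Vertex) : D.SurgeryDart K → D.SurgeryDart K
  | old x => old (D.rev x)
  | arcNext x => arcPrev (D.rotAt K x)
  | arcPrev x => arcNext ((D.rotAt K)⁻¹ x)
  | sideNext x => sidePrev (D.rotAt K x)
  | sidePrev x => sideNext ((D.rotAt K)⁻¹ x)

theorem surgeryRev_involutive (K : Set D.Vertex) : Function.Involutive (D.surgeryRev K) := by
  rintro (x | x | x | x | x) <;> simp [surgeryRev, D.rev_rev]

open SurgeryDart in
/-- The surface `S` with the graph `Γ_D`, for the set `K` of dealternators.  The sphere is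
replaced inside of the disc `O` around each dealternator by two bands: `[0,1] × [0,1]` glued to
opposite arcs of the boundary of `O`.  The removed faces (one for each dealternator) are those
bounded by the four sides of the bands.  The edges of `Γ_D` are those of the projection
(outside of the discs `O`) and the sides of the bands. -/
def surface (K : Set D.Vertex) : GraphSurface.{u} :=
  let M : CombMap.{u} :=
    { Dart := D.SurgeryDart K
      rot := D.surgeryRot K
      rev := (D.surgeryRev_involutive K).toPerm
      rev_rev := D.surgeryRev_involutive K
      rev_ne := by
        rintro (x | x | x | x | x) <;>
          simp [surgeryRev, D.rev_ne] }
  { toCombMap := M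
    hole := {f | ∃ x : D.DartAt K, f = M.faceOf (sidePrev x)}
    graph := {e | (∃ x ∈ D.proj, e = old x) ∨ (∃ x, e = sideNext x) ∨ ∃ x, e = sidePrev x}
    rev_mem_graph := by
      rintro _ (⟨x, hx, rfl⟩ | ⟨x, rfl⟩ | ⟨x, rfl⟩)
      · exact Or.inl ⟨D.rev x, D.rev_mem_proj x hx, rfl⟩
      · exact Or.inr (Or.inr ⟨_, rfl⟩)
      · exact Or.inr (Or.inl ⟨_, rfl⟩) }

/-- The regions of `S ∖ Γ_D`. -/
abbrev Region (K : Set D.Vertex) : Type u := (D.surface K).Region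

end LinkDiagram

end

/-! Cut `S` along `Γ_D` and let b be the number of boundary circles of the result. The theorem is
the composite of |s_A D| + |s_B D| = b and b = r + s.

For the first equality, switch the dealternators. In the resulting alternating diagram every edge of
the projection can be directed from an overpass to an underpass (components without crossings are
directed by a checkerboard colouring); this is `IsAlternating.exists_type`. A boundary circle runs
either always along or always against these directions. At an ordinary crossing it turns as one
smoothing prescribes; at a dealternator it follows the side of a band instead of turning, which is
the same smoothing of the original, unswitched crossing. So the circles of one type form s_A D and
those of the other form s_B D (`card_circle_eq`, `card_circles`).

For the second equality, every region has non-empty boundary and genus zero, so it has one boundary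
circle more than the rank of its first homology. Genus zero comes from the checkerboard colouring: a
band joins opposite corners at a crossing, which have the same colour, so each region has one
colour. Within one colour there is a single band at each dealternator, and it can be laid across the
disc `O` in the sphere.

Genus is handled through pairs of permutations: `twiceGenus φ γ` has the cycles of φ as polygons, γ
as the gluing, and the cycles of φγ as vertices and boundary circles. Splitting or joining cycles by
a transposition within a cycle of γ or of φγ never increases it (`twiceGenus_mul_swap_le`). This
gives nonnegativity, the existence of the checkerboard colouring (through a double cover of the
sphere), and genus zero for the cut surface (`twiceGenus_gluePerm`). On the homological side,
`h1Rank_add` expresses the rank by cell counts. Comparing both counts of the Euler characteristic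
yields b = r + s. -/

noncomputable section

/-! ## Counting classes of relations and cycles of permutations -/

section Classes

variable {X : Type*}

/-- The number of classes of the equivalence relation generated by `r`. -/
def numClasses (r : X → X → Prop) : ℕ := Nat.card (Quot r)

theorem quot_mk_eq_of_rel {r : X → X → Prop} {x y : X} (h : r x y) :
    Quot.mk r y = Quot.mk r x := (Quot.sound h).symm

theorem numClasses_le [Finite X] {r s : X → X → Prop}
    (h : ∀ x y, r x y → Quot.mk s x = Quot.mk s y) : numClasses s ≤ numClasses r := by
  refine Nat.card_le_card_of_surjective (Quot.lift (Quot.mk s) h) ?_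
  rintro ⟨x⟩
  exact ⟨Quot.mk r x, rfl⟩

theorem numClasses_congr [Finite X] {r s : X → X → Prop}
    (h : ∀ x y, r x y → Quot.mk s x = Quot.mk s y)
    (h' : ∀ x y, s x y → Quot.mk r x = Quot.mk r y) : numClasses r = numClasses s :=
  le_antisymm (numClasses_le h') (numClasses_le h)

theorem numClasses_lt [Finite X] {r s : X → X → Prop}
    (h : ∀ x y, r x y → Quot.mk s x = Quot.mk s y) {x y : X}
    (hs : Quot.mk s x = Quot.mk s y) (hr : Quot.mk r x ≠ Quot.mk r y) :
    numClasses s < numClasses r := by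
  have hsurj : Function.Surjective (Quot.lift (Quot.mk s) h : Quot r → Quot s) := by
    rintro ⟨z⟩
    exact ⟨Quot.mk r z, rfl⟩
  refine lt_of_le_of_ne (Nat.card_le_card_of_surjective _ hsurj) fun e => hr ?_
  have hb := (Nat.bijective_iff_surjective_and_card
    (Quot.lift (Quot.mk s) h : Quot r → Quot s)).2 ⟨hsurj, e.symm⟩
  exact hb.1 hs

/-- One extra generating pair merges at most two classes. The map `g` redirects the class of `x` to
that of `y`, and `none` recovers the class of `x`. -/
theorem numClasses_le_add_pair [Finite X] {r s : X → X → Prop} (x y : X)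
    (h : ∀ a b, s a b → Quot.mk r a = Quot.mk r b ∨ (a = x ∧ b = y)) :
    numClasses r ≤ numClasses s + 1 := by
  classical
  let g : Quot s → Quot r := Quot.lift
    (fun z => if Quot.mk r z = Quot.mk r x then Quot.mk r y else Quot.mk r z) (by
      intro a b hab
      rcases h a b hab with e | ⟨rfl, rfl⟩
      · simp only [e]
      · by_cases e : Quot.mk r b = Quot.mk r a <;> simp [e])
  let g' : Option (Quot s) → Quot r := fun o => o.elim (Quot.mk r x) g
  have hs : Function.Surjective g' := by
    rintro ⟨z⟩
    by_cases e : Quot.mk r z = Quot.mk r x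
    · exact ⟨none, e.symm⟩
    · exact ⟨some (Quot.mk s z), if_neg e⟩
  simpa [numClasses, Finite.card_option] using Nat.card_le_card_of_surjective g' hs

/-- Each restricted relation leaves the points of the other part as singleton classes; the two
restrictions together have `Nat.card X` of these. -/
theorem numClasses_add_card [Finite X] {r : X → X → Prop} (B : Set X)
    (h : ∀ x y, r x y → (x ∈ B ↔ y ∈ B)) :
    numClasses r + Nat.card X =
      numClasses (fun x y => x ∈ B ∧ r x y) + numClasses (fun x y => x ∉ B ∧ r x y) := by
  classical
  let r₁ := fun x y => x ∈ B ∧ r x y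
  let r₂ := fun x y => x ∉ B ∧ r x y
  let f : Quot r ⊕ X → Quot r₁ ⊕ Quot r₂ := Sum.elim
    (Quot.lift (fun x => if x ∈ B then Sum.inl (Quot.mk r₁ x) else Sum.inr (Quot.mk r₂ x)) (by
      intro x y hxy
      by_cases hx : x ∈ B
      · have hy := (h x y hxy).1 hx
        have e : Quot.mk r₁ x = Quot.mk r₁ y := Quot.sound ⟨hx, hxy⟩
        simp only [hx, hy, if_true, e]
      · have hy : y ∉ B := fun hy => hx ((h x y hxy).2 hy)
        have e : Quot.mk r₂ x = Quot.mk r₂ y := Quot.sound ⟨hx, hxy⟩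
        simp only [hx, hy, if_false, e]))
    (fun x => if x ∈ B then Sum.inr (Quot.mk r₂ x) else Sum.inl (Quot.mk r₁ x))
  let g : Quot r₁ ⊕ Quot r₂ → Quot r ⊕ X := Sum.elim
    (Quot.lift (fun x => if x ∈ B then Sum.inl (Quot.mk r x) else Sum.inr x) (by
      rintro x y ⟨hx, hxy⟩
      have e : Quot.mk r x = Quot.mk r y := Quot.sound hxy
      simp only [hx, (h x y hxy).1 hx, if_true, e]))
    (Quot.lift (fun x => if x ∈ B then Sum.inr x else Sum.inl (Quot.mk r x)) (by
      rintro x y ⟨hx, hxy⟩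
      have hy : y ∉ B := fun hy => hx ((h x y hxy).2 hy)
      have e : Quot.mk r x = Quot.mk r y := Quot.sound hxy
      simp only [hx, hy, if_false, e]))
  have hgf : Function.LeftInverse g f := by
    rintro (q | x)
    · induction q using Quot.ind with | mk x => by_cases hx : x ∈ B <;> simp [f, g, hx]
    · by_cases hx : x ∈ B <;> simp [f, g, hx]
  have hfg : Function.RightInverse g f := by
    rintro (q | q) <;>
      induction q using Quot.ind with | mk x => by_cases hx : x ∈ B <;> simp [f, g, hx]
  simpa [numClasses, Nat.card_sum] using Nat.card_congr (Equiv.mk f g hgf hfg)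

/-- An involution `f` has `(card X + card of the fixed points) / 2` orbits. -/
theorem two_mul_numClasses_involutive [Finite X] {f : X → X} (hf : Function.Involutive f) :
    2 * numClasses (fun x y => y = f x) = Nat.card X + Nat.card {x // f x = x} := by
  classical
  have := Fintype.ofFinite X
  let r := fun x y => y = f x
  have := Fintype.ofFinite (Quot r)
  have key : ∀ x y, Quot.mk r x = Quot.mk r y ↔ x = y ∨ x = f y := by
    intro x y
    constructor
    · intro e
      replace e := Quot.eqvGen_exact e
      induction e with
      | rel a b h => right; rw [h, hf]
      | refl a => left; rfl
      | symm a b _ ih =>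
        rcases ih with h | h
        · exact Or.inl h.symm
        · right; rw [h, hf]
      | trans a b c h1 h2 ih1 ih2 =>
        rcases ih1 with h | h <;> rcases ih2 with h' | h' <;> subst h h' <;> simp [hf _]
    · rintro (rfl | rfl)
      · rfl
      · exact (Quot.sound (r := r) rfl).symm
  have h1 : Fintype.card X = ∑ q : Quot r, (Finset.univ.filter fun x => Quot.mk r x = q).card :=
    Finset.card_eq_sum_card_fiberwise (fun x _ => Finset.mem_univ _)
  have h2 : (Finset.univ.filter fun x => f x = x).card =
      ∑ q : Quot r, ((Finset.univ.filter fun x => f x = x).filter fun x => Quot.mk r x = q).card :=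
    Finset.card_eq_sum_card_fiberwise (fun x _ => Finset.mem_univ _)
  have h3 : ∀ q : Quot r, (Finset.univ.filter fun x => Quot.mk r x = q).card +
      ((Finset.univ.filter fun x => f x = x).filter fun x => Quot.mk r x = q).card = 2 := by
    rintro ⟨y⟩
    by_cases hy : f y = y
    · have a1 : (Finset.univ.filter fun x => Quot.mk r x = Quot.mk r y) = {y} := by
        ext x; simp [key, hy]
      have a2 : ((Finset.univ.filter fun x => f x = x).filter
          fun x => Quot.mk r x = Quot.mk r y) = {y} := by
        ext x; simp only [Finset.mem_filter, Finset.mem_univ, true_and, key, hy,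
          Finset.mem_singleton, or_self]
        constructor
        · exact fun h => h.2
        · rintro rfl; exact ⟨hy, rfl⟩
      rw [a1, a2]; rfl
    · have a1 : (Finset.univ.filter fun x => Quot.mk r x = Quot.mk r y) = {y, f y} := by
        ext x; simp [key]
      have a2 : ((Finset.univ.filter fun x => f x = x).filter
          fun x => Quot.mk r x = Quot.mk r y) = ∅ := by
        ext x; simp only [Finset.mem_filter, Finset.mem_univ, true_and, key,
          Finset.notMem_empty, iff_false]
        rintro ⟨hx, rfl | rfl⟩
        · exact hy hx
        · rw [hf y] at hx; exact hy hx.symm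
      rw [a1, a2, Finset.card_pair (Ne.symm hy)]; rfl
  have h4 : Nat.card {x // f x = x} = (Finset.univ.filter fun x => f x = x).card := by
    rw [Nat.card_eq_fintype_card, Fintype.card_subtype]
  rw [h4, Nat.card_eq_fintype_card, h1, h2, ← Finset.sum_add_distrib,
    Finset.sum_congr rfl fun q _ => h3 q]
  simp [numClasses, r, Nat.card_eq_fintype_card, mul_comm]

end Classes

/-! ### Cycles, orbits and the genus of a pair of permutations -/

section Perms

open Equiv

variable {X : Type*}

/-- The number of cycles of a permutation, fixed points included. -/
def numCycles (γ : Perm X) : ℕ := numClasses fun x y => y = γ x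

/-- The number of orbits of the group generated by two permutations. -/
def numOrbits (φ γ : Perm X) : ℕ := numClasses fun x y => y = φ x ∨ y = γ x

theorem mk_eq_iff_sameCycle (γ : Perm X) (x y : X) :
    Quot.mk (fun x y => y = γ x) x = Quot.mk (fun x y => y = γ x) y ↔ γ.SameCycle x y := by
  constructor
  · intro h
    replace h := Quot.eqvGen_exact h
    induction h with
    | rel a b h => subst h; exact (Perm.SameCycle.refl γ a).apply_right
    | refl a => exact Perm.SameCycle.refl γ a
    | symm a b h ih => exact ih.symm
    | trans a b c h1 h2 ih1 ih2 => exact ih1.trans ih2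
  · rintro ⟨n, rfl⟩
    induction n with
    | zero => rfl
    | succ n ih => rw [ih, add_comm, zpow_add, zpow_one]; exact Quot.sound rfl
    | pred n ih =>
      rw [ih]
      have : (γ ^ (-(n : ℤ))) x = γ ((γ ^ (-(n : ℤ) - 1)) x) := by
        rw [← Perm.mul_apply, ← zpow_one_add]; congr 2; ring
      rw [this]; exact (Quot.sound (r := fun x y => y = γ x) rfl).symm

theorem card_quotient_sameCycle (γ : Perm X) :
    Nat.card (Quotient (Perm.SameCycle.setoid γ)) = numCycles γ :=
  Nat.card_congr
    { toFun := Quotient.lift (Quot.mk _) fun x y h => (mk_eq_iff_sameCycle γ x y).2 h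
      invFun := Quot.lift (Quotient.mk _) fun x y h => Quotient.sound
        ((mk_eq_iff_sameCycle γ x y).1 (Quot.sound h))
      left_inv := by rintro ⟨x⟩; rfl
      right_inv := by rintro ⟨x⟩; rfl }

/-- With k least such that γ^k x = y, the product runs from y through γ x, …, γ^k x = y and closes
up there, never meeting x. -/
theorem not_sameCycle_mul_swap [DecidableEq X] [Finite X] {γ : Perm X} {x y : X} (hxy : x ≠ y)
    (h : γ.SameCycle x y) : ¬ (γ * swap x y).SameCycle y x := by
  classical
  obtain ⟨m, hm⟩ := h.exists_nat_pow_eq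
  have hex : ∃ k, (γ ^ k) x = y := ⟨m, hm⟩
  let k := Nat.find hex
  have hk : (γ ^ k) x = y := Nat.find_spec hex
  have hmin : ∀ j < k, (γ ^ j) x ≠ y := fun j hj => Nat.find_min hex hj
  have hk0 : k ≠ 0 := fun h0 => hxy (by rw [h0] at hk; simpa using hk)
  have hx : ∀ i, 1 ≤ i → i ≤ k → (γ ^ i) x ≠ x := by
    intro i h1 hi e
    refine hmin (k - i) (by omega) ?_
    have : (γ ^ (k - i)) ((γ ^ i) x) = y := by
      rw [← Perm.mul_apply, ← pow_add, Nat.sub_add_cancel hi, hk]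
    rwa [e] at this
  have inv : ∀ n, ∃ i, 1 ≤ i ∧ i ≤ k ∧ ((γ * swap x y) ^ n) y = (γ ^ i) x := by
    intro n
    induction n with
    | zero => exact ⟨k, by omega, le_rfl, hk.symm⟩
    | succ n ih =>
      obtain ⟨i, h1, hi, e⟩ := ih
      rw [pow_succ', Perm.mul_apply, e, Perm.mul_apply]
      rcases eq_or_lt_of_le hi with rfl | hlt
      · exact ⟨1, le_rfl, by omega, by rw [hk, swap_apply_right, pow_one]⟩
      · refine ⟨i + 1, by omega, hlt, ?_⟩
        rw [swap_apply_of_ne_of_ne (hx i h1 hi) (hmin i hlt), pow_succ', Perm.mul_apply]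
  intro hs
  obtain ⟨n, hn⟩ := hs.exists_nat_pow_eq
  obtain ⟨i, h1, hi, e⟩ := inv n
  exact hx i h1 hi (e.symm.trans hn)

/-- The product sends x to γ y and then follows the γ-cycle of y, which does not contain x, until it
reaches y. -/
theorem sameCycle_mul_swap [DecidableEq X] [Finite X] {γ : Perm X} {x y : X}
    (h : ¬ γ.SameCycle x y) : (γ * swap x y).SameCycle x y := by
  by_contra h'
  have hxy : x ≠ y := by rintro rfl; exact h (Perm.SameCycle.refl _ _)
  obtain ⟨m, hm0, hm⟩ : ∃ m, 0 < m ∧ (γ ^ m) y = y := by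
    refine ⟨orderOf γ, orderOf_pos γ, by rw [pow_orderOf_eq_one]; rfl⟩
  have key : ∀ i, (γ * swap x y).SameCycle x ((γ ^ (i + 1)) y) := by
    intro i
    induction i with
    | zero =>
      refine ⟨1, ?_⟩
      simp
    | succ i ih =>
      have hy : (γ ^ (i + 1)) y ≠ y := fun e => h' (by rwa [e] at ih)
      have hx : (γ ^ (i + 1)) y ≠ x := fun e => h (Perm.SameCycle.symm ⟨(i + 1 : ℕ), by
        rw [zpow_natCast]; exact e⟩)
      have : (γ ^ (i + 1 + 1)) y = (γ * swap x y) ((γ ^ (i + 1)) y) := by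
        rw [Perm.mul_apply, swap_apply_of_ne_of_ne hx hy, pow_succ', Perm.mul_apply]
      rw [this]
      exact ih.apply_right
  have := key (m - 1)
  rw [Nat.sub_add_cancel hm0, hm] at this
  exact h' this

theorem numCycles_lt_mul_swap [DecidableEq X] [Finite X] {γ : Perm X} {x y : X} (hxy : x ≠ y)
    (h : γ.SameCycle x y) : numCycles γ < numCycles (γ * swap x y) := by
  have h0 := (mk_eq_iff_sameCycle γ x y).2 h
  refine numClasses_lt (x := x) (y := y) ?_ h0 fun e =>
    not_sameCycle_mul_swap hxy h ((mk_eq_iff_sameCycle _ x y).1 e).symm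
  rintro a b rfl
  have hs : ∀ z : X, Quot.mk (fun x y => y = γ x) z = Quot.mk (fun x y => y = γ x) (γ z) :=
    fun z => Quot.sound rfl
  rw [Perm.mul_apply, ← hs]
  by_cases hx : a = x
  · subst hx; rw [swap_apply_left]; exact h0
  by_cases hy : a = y
  · subst hy; rw [swap_apply_right]; exact h0.symm
  rw [swap_apply_of_ne_of_ne hx hy]

theorem mk_eq_mk_of_mul_swap {Y : Type*} [DecidableEq X] {γ : Perm X} {x y : X} (q : X → Y)
    (h : ∀ z, q ((γ * swap x y) z) = q z) (hxy : q x = q y) (z : X) : q (γ z) = q z := by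
  have := h (swap x y z)
  rw [Perm.mul_apply, swap_apply_self] at this
  rw [this]
  by_cases hx : z = x
  · subst hx; rw [swap_apply_left]; exact hxy.symm
  by_cases hy : z = y
  · subst hy; rw [swap_apply_right]; exact hxy
  rw [swap_apply_of_ne_of_ne hx hy]

theorem numCycles_mul_swap_le [DecidableEq X] [Finite X] (γ : Perm X) (x y : X) :
    numCycles (γ * swap x y) ≤ numCycles γ + 1 := by
  let s : X → X → Prop := fun a b => b = (γ * swap x y) a ∨ (a = x ∧ b = y)
  have h1 : numClasses s ≤ numCycles γ := by
    refine numClasses_le fun a b h => ?_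
    rw [h]
    exact (mk_eq_mk_of_mul_swap (γ := γ) (x := x) (y := y) (Quot.mk s)
      (fun z => quot_mk_eq_of_rel (Or.inl rfl)) (Quot.sound (Or.inr ⟨rfl, rfl⟩)) a).symm
  refine (numClasses_le_add_pair (s := s) x y fun a b h => ?_).trans (Nat.add_le_add_right h1 1)
  exact h.imp_left fun h => Quot.sound h

theorem numCycles_le_mul_swap [DecidableEq X] [Finite X] (γ : Perm X) (x y : X) :
    numCycles γ ≤ numCycles (γ * swap x y) + 1 := by
  simpa [mul_assoc] using numCycles_mul_swap_le (γ * swap x y) x y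

theorem numOrbits_mul_swap_le_add_one [DecidableEq X] [Finite X] (φ γ : Perm X) (x y : X) :
    numOrbits φ (γ * swap x y) ≤ numOrbits φ γ + 1 := by
  let s : X → X → Prop := fun a b => (b = φ a ∨ b = (γ * swap x y) a) ∨ (a = x ∧ b = y)
  have h1 : numClasses s ≤ numOrbits φ γ := by
    refine numClasses_le fun a b h => ?_
    rcases h with h | h
    · exact Quot.sound (Or.inl (Or.inl h))
    · rw [h]
      exact (mk_eq_mk_of_mul_swap (γ := γ) (x := x) (y := y) (Quot.mk s)
        (fun z => quot_mk_eq_of_rel (Or.inl (Or.inr rfl)))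
        (Quot.sound (Or.inr ⟨rfl, rfl⟩)) a).symm
  refine (numClasses_le_add_pair (s := s) x y fun a b h => ?_).trans (Nat.add_le_add_right h1 1)
  exact h.imp_left fun h => Quot.sound h

/-- Either hypothesis puts x and y into one orbit of φ and the new permutation, so γ preserves the
new orbits. -/
theorem numOrbits_mul_swap_le [DecidableEq X] [Finite X] {φ γ : Perm X} {x y : X}
    (h : (γ * swap x y).SameCycle x y ∨ (φ * γ * swap x y).SameCycle x y) :
    numOrbits φ (γ * swap x y) ≤ numOrbits φ γ := by
  let r : X → X → Prop := fun a b => b = φ a ∨ b = (γ * swap x y) a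
  have hφ : ∀ z, Quot.mk r (φ z) = Quot.mk r z := fun z => quot_mk_eq_of_rel (Or.inl rfl)
  have hγ : ∀ z, Quot.mk r ((γ * swap x y) z) = Quot.mk r z :=
    fun z => quot_mk_eq_of_rel (Or.inr rfl)
  have hxy : Quot.mk r x = Quot.mk r y := by
    rcases h with h | h
    · have h := (mk_eq_iff_sameCycle _ x y).2 h
      exact congrArg (Quot.lift (Quot.mk r) fun a b hab => by rw [hab, hγ]) h
    · have h := (mk_eq_iff_sameCycle _ x y).2 h
      exact congrArg (Quot.lift (Quot.mk r) fun a b hab => by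
        rw [hab, mul_assoc, Perm.mul_apply, hφ, hγ]) h
  refine numClasses_le fun a b h => ?_
  rcases h with h | h
  · exact Quot.sound (Or.inl h)
  · rw [h]
    exact (mk_eq_mk_of_mul_swap (γ := γ) (x := x) (y := y) (Quot.mk r) hγ hxy a).symm

/-- Twice the genus of the surface with polygons the cycles of `φ`, glued according to `γ`. -/
def twiceGenus (φ γ : Perm X) : ℤ :=
  Nat.card X + 2 * numOrbits φ γ - numCycles φ - numCycles γ - numCycles (φ * γ)

/-- If both cycles split, two cycles are gained, which pays for at most one new orbit (counted
twice). If one splits while the other merges, the cycle counts balance, and the merged cycle keeps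
the number of orbits from growing. -/
theorem twiceGenus_mul_swap_le [DecidableEq X] [Finite X] {φ γ : Perm X} {x y : X}
    (h : γ.SameCycle x y ∨ (φ * γ).SameCycle x y) :
    twiceGenus φ (γ * swap x y) ≤ twiceGenus φ γ := by
  by_cases hxy : x = y
  · subst hxy; rw [swap_self, ← Perm.one_def, mul_one]
  have a1 := numCycles_le_mul_swap γ x y
  have a2 := numCycles_le_mul_swap (φ * γ) x y
  have a3 := numOrbits_mul_swap_le_add_one φ γ x y
  have e : φ * (γ * swap x y) = φ * γ * swap x y := (mul_assoc _ _ _).symm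
  simp only [twiceGenus, e]
  by_cases h1 : γ.SameCycle x y <;> by_cases h2 : (φ * γ).SameCycle x y
  · have := numCycles_lt_mul_swap hxy h1
    have := numCycles_lt_mul_swap hxy h2
    omega
  · have := numCycles_lt_mul_swap hxy h1
    have := numOrbits_mul_swap_le (φ := φ) (γ := γ) (Or.inr (sameCycle_mul_swap h2))
    omega
  · have := numCycles_lt_mul_swap hxy h2
    have := numOrbits_mul_swap_le (φ := φ) (γ := γ) (Or.inl (sameCycle_mul_swap h1))
    omega
  · tauto

/-- Removing the elements of `Y` from the cycles of the gluing permutation does not increase the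
genus (stated for the case that at most one of them is removed between two remaining ones). -/
theorem twiceGenus_bypass_le [Finite X] (φ β γ : Perm X) (Y : Finset X)
    (hY : ∀ y ∈ Y, γ y = y)
    (hY' : ∀ x ∉ Y, (β x ∉ Y ∧ γ x = β x) ∨
      (β x ∈ Y ∧ β (β x) ∉ Y ∧ γ x = β (β x))) :
    twiceGenus φ γ ≤ twiceGenus φ β := by
  classical
  induction Y using Finset.induction_on generalizing β with
  | empty =>
    have : γ = β := Equiv.ext fun x => by simpa using hY' x
    rw [this]
  | insert y Y hy ih =>
    -- This product fixes `y` and sends its predecessor directly to its successor: `y` is cut out of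
    -- its cycle.
    have h1 : twiceGenus φ (β * swap (β⁻¹ y) y) ≤ twiceGenus φ β :=
      twiceGenus_mul_swap_le (Or.inl ⟨1, by simp⟩)
    refine (ih _ (fun z hz => hY z (Finset.mem_insert_of_mem hz)) fun x hx => ?_).trans h1
    have hβ : ∀ z, z ≠ y → β z ≠ y → (β * swap (β⁻¹ y) y) z = β z := fun z h h' => by
      rw [Perm.mul_apply, swap_apply_of_ne_of_ne _ h]
      rintro rfl; exact h' (β.apply_symm_apply _)
    have hβ' : ∀ z, β z = y → (β * swap (β⁻¹ y) y) z = β y := fun z h => by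
      rw [Perm.mul_apply, show β⁻¹ y = z by rw [← h]; exact β.symm_apply_apply z, swap_apply_left]
    have hy1 : (β * swap (β⁻¹ y) y) y = y := by simp
    by_cases hxy : x = y
    · subst hxy
      left
      rw [hy1]
      exact ⟨hx, hY x (Finset.mem_insert_self _ _)⟩
    have hn : ∀ z, z ∉ insert y Y → z ≠ y ∧ z ∉ Y := fun z hz => by simpa using hz
    rcases hY' x (by simp [hxy, hx]) with ⟨h2, h3⟩ | ⟨h4, h2, h3⟩
    · left
      rw [hβ x hxy (hn _ h2).1]
      exact ⟨(hn _ h2).2, h3⟩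
    · by_cases hb : β x = y
      · left
        rw [hβ' x hb, ← hb]
        exact ⟨(hn _ h2).2, h3⟩
      · right
        rw [hβ x hxy hb, hβ _ hb (hn _ h2).1]
        exact ⟨(Finset.mem_insert.1 h4).resolve_left hb, (hn _ h2).2, h3⟩

theorem twiceGenus_one [Finite X] (φ : Perm X) : twiceGenus φ 1 = 0 := by
  have h1 : numCycles (1 : Perm X) = Nat.card X := by
    refine (Nat.card_congr (Equiv.ofBijective (Quot.mk _)
      ⟨fun x y h => ?_, Quot.mk_surjective⟩)).symm
    simpa using (mk_eq_iff_sameCycle 1 x y).1 h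
  have h2 : numOrbits φ 1 = numCycles φ := by
    refine numClasses_congr (fun x y h => ?_) fun x y h => Quot.sound (Or.inl h)
    rcases h with h | rfl
    · exact Quot.sound h
    · rfl
  rw [twiceGenus, h1, h2, mul_one]; ring

/-- Removing every element from the cycles of `γ` leaves the identity, which has genus zero, and the
genus has not increased on the way. -/
theorem twiceGenus_nonneg [Finite X] (φ γ : Perm X) : 0 ≤ twiceGenus φ γ := by
  have := Fintype.ofFinite X
  rw [← twiceGenus_one φ]
  exact twiceGenus_bypass_le φ γ 1 Finset.univ (fun _ _ => rfl)
    fun x hx => (hx (Finset.mem_univ x)).elim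

theorem sameCycle_congr [Finite X] {μ μ' : Perm X} {x y : X}
    (h : ∀ z, μ.SameCycle x z → μ' z = μ z) (hxy : μ.SameCycle x y) : μ'.SameCycle x y := by
  obtain ⟨n, rfl⟩ := hxy.exists_nat_pow_eq
  clear hxy
  induction n with
  | zero => exact Perm.SameCycle.refl _ _
  | succ n ih =>
    rw [pow_succ', Perm.mul_apply, ← h _ ⟨n, by simp⟩]
    exact ih.apply_right

/-- Gluing further pairs `{x, κ x}` does not increase the genus if each of them lies on one boundary
component and there is only one pair on each boundary component. -/
theorem twiceGenus_mul_involutive_le [Finite X] (φ γ κ : Perm X) (hκ : ∀ x, κ (κ x) = x)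
    (h1 : ∀ x, κ x ≠ x → (φ * γ).SameCycle x (κ x))
    (h2 : ∀ x y, κ x ≠ x → κ y ≠ y → (φ * γ).SameCycle x y → y = x ∨ y = κ x) :
    twiceGenus φ (γ * κ) ≤ twiceGenus φ γ := by
  classical
  have := Fintype.ofFinite X
  induction hn : κ.support.card using Nat.strong_induction_on generalizing κ with
  | _ n ih =>
  subst hn
  by_cases hx : ∃ x, κ x ≠ x
  · obtain ⟨x, hx⟩ := hx
    -- Induction on the support: `κ'` is `κ` without the pair `{x, κ x}`.
    let κ' := κ * swap x (κ x)
    have e1 : κ' x = x := by simp [κ', hκ]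
    have e2 : κ' (κ x) = κ x := by simp [κ']
    have e3 : ∀ y, y ≠ x → y ≠ κ x → κ' y = κ y := fun y h h' => by
      simp [κ', swap_apply_of_ne_of_ne h h']
    have e4 : ∀ y, κ' y ≠ y → y ≠ x ∧ y ≠ κ x ∧ κ' y = κ y := by
      intro y hy
      have a : y ≠ x := by rintro rfl; exact hy e1
      have b : y ≠ κ x := by rintro rfl; exact hy e2
      exact ⟨a, b, e3 y a b⟩
    have e5 : ∀ y, κ' y ≠ y → κ y ≠ y := fun y hy => (e4 y hy).2.2 ▸ hy
    have hlt : κ'.support.card < κ.support.card := by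
      refine Finset.card_lt_card ⟨fun y hy => ?_, fun h => ?_⟩
      · rw [Perm.mem_support] at hy ⊢; exact e5 y hy
      · exact Perm.mem_support.1 (h (Perm.mem_support.2 hx)) e1
    have hκ' : ∀ y, κ' (κ' y) = y := by
      intro y
      by_cases hy : κ' y = y
      · rw [hy, hy]
      · obtain ⟨a, b, c⟩ := e4 y hy
        rw [c, e3, hκ]
        · rintro h; apply b; rw [← h, hκ]
        · intro h; exact a (κ.injective h)
    have := ih _ hlt κ' hκ' (fun y hy => (e4 y hy).2.2 ▸ h1 y (e5 y hy))
      (fun y z hy hz h => (e4 y hy).2.2 ▸ h2 y z (e5 y hy) (e5 z hz) h) rfl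
    refine le_trans ?_ this
    have e6 : γ * κ = γ * κ' * swap x (κ x) := by simp [κ', mul_assoc]
    rw [e6]
    -- The other pairs lie on other cycles of `φ * γ`, so `κ'` fixes the cycle of `x` pointwise, and
    -- `x`, `κ x` still share a cycle after gluing by `κ'`.
    refine twiceGenus_mul_swap_le (Or.inr (sameCycle_congr (fun z hz => ?_) (h1 x hx)))
    rw [← mul_assoc, Perm.mul_apply]
    congr 1
    by_contra hz'
    have := h2 x z hx (e5 z hz') hz
    have := e4 z hz'
    tauto
  · push Not at hx
    rw [show κ = 1 from Equiv.ext hx, mul_one]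

/-- If the polygons fall into two parts and `γ` glues polygons of the same part, then the genus
is the sum of the genera of the two parts. -/
theorem twiceGenus_eq_add [Finite X] (B : Set X) (φ γ γ₁ γ₂ : Perm X)
    (hφ : ∀ x, φ x ∈ B ↔ x ∈ B) (hγ : ∀ x, γ x ∈ B ↔ x ∈ B)
    (h1 : ∀ x ∈ B, γ₁ x = γ x) (h1' : ∀ x ∉ B, γ₁ x = x)
    (h2 : ∀ x ∉ B, γ₂ x = γ x) (h2' : ∀ x ∈ B, γ₂ x = x) :
    twiceGenus φ γ = twiceGenus φ γ₁ + twiceGenus φ γ₂ := by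
  have hγ₁ : ∀ x, γ₁ x ∈ B ↔ x ∈ B := fun x => by
    by_cases hx : x ∈ B
    · rw [h1 x hx, hγ]
    · rw [h1' x hx]
  have hγ₂ : ∀ x, γ₂ x ∈ B ↔ x ∈ B := fun x => by
    by_cases hx : x ∈ B
    · rw [h2' x hx]
    · rw [h2 x hx, hγ]
  have cyc : ∀ σ : Perm X, (∀ x, σ x ∈ B ↔ x ∈ B) → numCycles σ + Nat.card X =
      numClasses (fun x y => x ∈ B ∧ y = σ x) + numClasses (fun x y => x ∉ B ∧ y = σ x) :=
    fun σ hσ => numClasses_add_card B fun x y h => by rw [h, hσ]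
  have orb : ∀ σ : Perm X, (∀ x, σ x ∈ B ↔ x ∈ B) → numOrbits φ σ + Nat.card X =
      numClasses (fun x y => x ∈ B ∧ (y = φ x ∨ y = σ x)) +
        numClasses (fun x y => x ∉ B ∧ (y = φ x ∨ y = σ x)) :=
    fun σ hσ => numClasses_add_card B fun x y h => by
      rcases h with h | h <;> rw [h] <;> simp [hφ, hσ]
  have c1 : ∀ σ τ : Perm X, (∀ x ∈ B, σ x = τ x) → numClasses (fun x y => x ∈ B ∧ y = σ x) =
      numClasses (fun x y => x ∈ B ∧ y = τ x) := by
    intro σ τ h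
    congr 1; ext x y
    exact and_congr_right fun hx => by rw [h x hx]
  have c2 : ∀ σ τ : Perm X, (∀ x ∉ B, σ x = τ x) → numClasses (fun x y => x ∉ B ∧ y = σ x) =
      numClasses (fun x y => x ∉ B ∧ y = τ x) := by
    intro σ τ h
    congr 1; ext x y
    exact and_congr_right fun hx => by rw [h x hx]
  have o1 : ∀ σ τ : Perm X, (∀ x ∈ B, σ x = τ x) →
      numClasses (fun x y => x ∈ B ∧ (y = φ x ∨ y = σ x)) =
      numClasses (fun x y => x ∈ B ∧ (y = φ x ∨ y = τ x)) := by
    intro σ τ h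
    congr 1; ext x y
    exact and_congr_right fun hx => by rw [h x hx]
  have o2 : ∀ σ τ : Perm X, (∀ x ∉ B, σ x = τ x) →
      numClasses (fun x y => x ∉ B ∧ (y = φ x ∨ y = σ x)) =
      numClasses (fun x y => x ∉ B ∧ (y = φ x ∨ y = τ x)) := by
    intro σ τ h
    congr 1; ext x y
    exact and_congr_right fun hx => by rw [h x hx]
  have one : ∀ x, (1 : Perm X) x ∈ B ↔ x ∈ B := fun x => Iff.rfl
  have mulB : ∀ σ : Perm X, (∀ x, σ x ∈ B ↔ x ∈ B) → ∀ x, (φ * σ) x ∈ B ↔ x ∈ B :=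
    fun σ h x => by rw [Perm.mul_apply, hφ, h]
  -- Each count c in the genus satisfies c(γ) + c(1) = c(γ₁) + c(γ₂), by splitting it over `B` and
  -- its complement; the vanishing genus of the identity then cancels.
  have g0 := twiceGenus_one φ
  have hm : ∀ σ τ : Perm X, ∀ x, σ x = τ x → (φ * σ) x = (φ * τ) x := fun σ τ x h => by
    rw [Perm.mul_apply, h, Perm.mul_apply]
  have := cyc γ hγ
  have := cyc γ₁ hγ₁
  have := cyc γ₂ hγ₂
  have := cyc 1 one
  have := orb γ hγ
  have := orb γ₁ hγ₁
  have := orb γ₂ hγ₂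
  have := orb 1 one
  have := cyc _ (mulB γ hγ)
  have := cyc _ (mulB γ₁ hγ₁)
  have := cyc _ (mulB γ₂ hγ₂)
  have := cyc _ (mulB 1 one)
  have := c1 γ₁ γ h1
  have := c1 γ₂ 1 h2'
  have := c2 γ₁ 1 h1'
  have := c2 γ₂ γ h2
  have := o1 γ₁ γ h1
  have := o1 γ₂ 1 h2'
  have := o2 γ₁ 1 h1'
  have := o2 γ₂ γ h2
  have := c1 (φ * γ₁) (φ * γ) fun x hx => hm _ _ x (h1 x hx)
  have := c1 (φ * γ₂) (φ * 1) fun x hx => hm _ _ x (h2' x hx)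
  have := c2 (φ * γ₁) (φ * 1) fun x hx => hm _ _ x (h1' x hx)
  have := c2 (φ * γ₂) (φ * γ) fun x hx => hm _ _ x (h2 x hx)
  simp only [twiceGenus] at g0 ⊢
  omega

end Perms

/-! ### First return of a permutation to a subset -/

section Slide

open Equiv

variable {X : Type*} (P : Set X) (μ : Perm X)

/-- Sliding an element outside of `P` along its cycle. -/
def SlideRel (a b : X) : Prop := a ∉ P ∧ b = μ a

/-- The number of cycles that do not meet `P`. -/
def numFree : ℕ := Nat.card {q : Quot (SlideRel P μ) // ∀ p ∈ P, Quot.mk _ p ≠ q}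

variable {P μ}

theorem slide_mk {a : X} (h : a ∉ P) :
    Quot.mk (SlideRel P μ) (μ a) = Quot.mk (SlideRel P μ) a := quot_mk_eq_of_rel ⟨h, rfl⟩

/-- Sliding is deterministic, hence confluent, and the elements of `P` are its normal forms. So a
class contains at most one of them. -/
theorem slide_injOn {a b : X} (ha : a ∈ P) (hb : b ∈ P)
    (h : Quot.mk (SlideRel P μ) a = Quot.mk (SlideRel P μ) b) : a = b := by
  have hj : Equivalence (Relation.Join (Relation.ReflTransGen (SlideRel P μ))) := by
    refine Relation.equivalence_join_reflTransGen ?_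
    rintro x y z ⟨_, rfl⟩ ⟨_, rfl⟩
    exact ⟨_, Relation.ReflGen.refl, Relation.ReflTransGen.refl⟩
  have key : Relation.Join (Relation.ReflTransGen (SlideRel P μ)) a b := by
    replace h := Quot.eqvGen_exact h
    clear ha hb
    induction h with
    | rel x y h => exact ⟨y, Relation.ReflTransGen.single h, Relation.ReflTransGen.refl⟩
    | refl x => exact hj.refl x
    | symm x y _ ih => exact hj.symm ih
    | trans x y z _ _ ih1 ih2 => exact hj.trans ih1 ih2
  obtain ⟨c, h1, h2⟩ := key
  have term : ∀ x ∈ P, Relation.ReflTransGen (SlideRel P μ) x c → x = c := by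
    intro x hx h
    rcases h.cases_head with h | ⟨d, h, _⟩
    · exact h
    · exact (h.1 hx).elim
  rw [term a ha h1, term b hb h2]

theorem sameCycle_of_slide {a b : X}
    (h : Quot.mk (SlideRel P μ) a = Quot.mk (SlideRel P μ) b) : μ.SameCycle a b := by
  rw [← mk_eq_iff_sameCycle]
  exact congrArg (Quot.lift (Quot.mk fun x y => y = μ x) fun x y h => Quot.sound h.2) h

variable (P μ)

theorem numClasses_slideRel [Finite X] :
    numClasses (SlideRel P μ) = Nat.card P + numFree P μ := by
  classical
  let f : P ⊕ {q : Quot (SlideRel P μ) // ∀ p ∈ P, Quot.mk _ p ≠ q} → Quot (SlideRel P μ) :=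
    Sum.elim (fun p => Quot.mk _ p.1) (fun q => q.1)
  have hf : Function.Bijective f := by
    constructor
    · rintro (⟨a, ha⟩ | ⟨a, ha⟩) (⟨b, hb⟩ | ⟨b, hb⟩) h
      · congr 2; exact slide_injOn ha hb h
      · exact (hb a ha h).elim
      · exact (ha b hb h.symm).elim
      · congr 2
    · intro q
      by_cases h : ∀ p ∈ P, Quot.mk _ p ≠ q
      · exact ⟨Sum.inr ⟨q, h⟩, rfl⟩
      · push Not at h
        obtain ⟨p, hp, e⟩ := h
        exact ⟨Sum.inl ⟨p, hp⟩, e⟩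
  rw [numFree, ← Nat.card_sum, numClasses]
  exact (Nat.card_congr (Equiv.ofBijective f hf)).symm

/-- The cycles of `μ` are those of the first return map to `P` and those not meeting `P`. -/
theorem numCycles_eq_add_numFree [Finite X] (ν : P → P)
    (hν : ∀ p : P, Quot.mk (SlideRel P μ) (ν p).1 = Quot.mk (SlideRel P μ) (μ p.1)) :
    numCycles μ = numClasses (fun p q : P => q = ν p) + numFree P μ := by
  classical
  let r : P → P → Prop := fun p q => q = ν p
  let Z := {q : Quot (SlideRel P μ) // ∀ p ∈ P, Quot.mk _ p ≠ q}
  let f : Quot (SlideRel P μ) → Quot r ⊕ Z := fun q =>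
    if h : ∃ p : P, Quot.mk _ p.1 = q then Sum.inl (Quot.mk r h.choose)
    else Sum.inr ⟨q, fun p hp e => h ⟨⟨p, hp⟩, e⟩⟩
  have fP : ∀ p : P, f (Quot.mk _ p.1) = Sum.inl (Quot.mk r p) := by
    intro p
    have h : ∃ p' : P, Quot.mk (SlideRel P μ) p'.1 = Quot.mk _ p.1 := ⟨p, rfl⟩
    have e : h.choose = p := Subtype.ext (slide_injOn h.choose.2 p.2 h.choose_spec)
    simp only [f, dif_pos h, e]
  have fZ : ∀ q : Z, f q.1 = Sum.inr q := by
    rintro ⟨q, hq⟩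
    have h : ¬ ∃ p : P, Quot.mk (SlideRel P μ) p.1 = q := fun ⟨p, e⟩ => hq p.1 p.2 e
    simp only [f, dif_neg h]
  let F : Quot (fun x y => y = μ x) → Quot r ⊕ Z := Quot.lift (fun x => f (Quot.mk _ x)) (by
    rintro x y rfl
    by_cases hx : x ∈ P
    · rw [← hν ⟨x, hx⟩, fP, fP ⟨x, hx⟩]
      exact congrArg _ (Quot.sound rfl)
    · rw [slide_mk hx])
  let c : Quot (SlideRel P μ) → Quot (fun x y => y = μ x) :=
    Quot.lift (Quot.mk _) fun x y h => Quot.sound h.2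
  let G : Quot r ⊕ Z → Quot (fun x y => y = μ x) := Sum.elim
    (Quot.lift (fun p => Quot.mk _ p.1) (by
      rintro p q rfl
      have e := congrArg c (hν p)
      exact (Quot.sound rfl : Quot.mk (fun x y => y = μ x) p.1 = _).trans e.symm))
    (fun q => c q.1)
  have hFG : Function.RightInverse G F := by
    rintro (q | ⟨q, hq⟩)
    · induction q using Quot.ind with | mk p => exact fP p
    · induction q using Quot.ind with | mk x => exact fZ ⟨_, hq⟩
  have hG : Function.Surjective G := by
    intro q
    induction q using Quot.ind with | mk x => ?_
    by_cases h : ∀ p ∈ P, Quot.mk (SlideRel P μ) p ≠ Quot.mk _ x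
    · exact ⟨Sum.inr ⟨_, h⟩, rfl⟩
    · push Not at h
      obtain ⟨p, hp, e⟩ := h
      exact ⟨Sum.inl (Quot.mk _ ⟨p, hp⟩), congrArg c e⟩
  have := Nat.card_congr (Equiv.ofBijective G ⟨hFG.injective, hG⟩)
  rw [Nat.card_sum] at this
  exact this.symm

/-- If sliding from `μ a` never met `P`, all iterates would stay in one sliding class; but they come
back to `a`, which is in `P`. -/
theorem exists_slide_eq [Finite X] {a : X} (ha : a ∈ P) :
    ∃ b ∈ P, Quot.mk (SlideRel P μ) b = Quot.mk (SlideRel P μ) (μ a) := by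
  by_contra! h
  have key : ∀ n : ℕ, Quot.mk (SlideRel P μ) ((μ ^ (n + 1)) a) = Quot.mk _ (μ a) := by
    intro n
    induction n with
    | zero => simp
    | succ n ih =>
      rw [pow_succ', Perm.mul_apply, ← ih]
      exact slide_mk fun hP => h _ hP ih
  have := key (orderOf μ - 1)
  rw [Nat.sub_add_cancel (orderOf_pos μ), pow_orderOf_eq_one] at this
  exact h a ha this

variable {P}

/-- The first element of `P` after an element of `P` on its cycle. -/
def firstReturn [Finite X] (a : P) : P :=
  ⟨(exists_slide_eq P μ a.2).choose, (exists_slide_eq P μ a.2).choose_spec.1⟩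

theorem slide_firstReturn [Finite X] (a : P) :
    Quot.mk (SlideRel P μ) (firstReturn μ a).1 = Quot.mk (SlideRel P μ) (μ a.1) :=
  (exists_slide_eq P μ a.2).choose_spec.2

theorem firstReturn_eq_of_mem [Finite X] (a : P) (h : μ a.1 ∈ P) :
    (firstReturn μ a).1 = μ a.1 :=
  slide_injOn (firstReturn μ a).2 h (slide_firstReturn μ a)

theorem sameCycle_firstReturn [Finite X] (a : P) : μ.SameCycle a.1 (firstReturn μ a).1 :=
  (Perm.SameCycle.refl μ a.1).apply_right.trans (sameCycle_of_slide (slide_firstReturn μ a)).symm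

/-- All iterates of `a` then stay in its sliding class, where `a` is the only element of `P`. -/
theorem eq_of_firstReturn_eq [Finite X] (a : P) (h : firstReturn μ a = a) {b : X} (hb : b ∈ P)
    (hab : μ.SameCycle a.1 b) : b = a.1 := by
  obtain ⟨n, rfl⟩ := hab.exists_nat_pow_eq
  have h' := slide_firstReturn μ a
  rw [h] at h'
  have key : ∀ n : ℕ, Quot.mk (SlideRel P μ) ((μ ^ n) a.1) = Quot.mk _ a.1 := by
    intro n
    induction n with
    | zero => rfl
    | succ n ih =>
      rw [pow_succ', Perm.mul_apply]
      by_cases hP : (μ ^ n) a.1 ∈ P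
      · rw [slide_injOn hP a.2 ih, ← h']
      · rw [slide_mk hP, ih]
  exact slide_injOn hb a.2 (key n)

end Slide

/-! ### Combinatorial maps and the genus of the sphere -/

namespace CombMap

open Equiv

variable (M : CombMap.{u})

theorem facePerm_apply (x : M.Dart) : M.facePerm x = M.rot⁻¹ (M.rev x) := rfl

theorem facePerm_rev (x : M.Dart) : M.facePerm (M.rev x) = M.rot⁻¹ x := by
  rw [facePerm_apply, M.rev_rev]

theorem facePerm_mul_rev : M.facePerm * M.rev = M.rot⁻¹ := Equiv.ext M.facePerm_rev

theorem rot_inv_rot (x : M.Dart) : M.rot⁻¹ (M.rot x) = x := M.rot.symm_apply_apply x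

theorem rot_rot_inv (x : M.Dart) : M.rot (M.rot⁻¹ x) = x := M.rot.apply_symm_apply x

theorem vertexOf_eq_iff {x y : M.Dart} : M.vertexOf x = M.vertexOf y ↔ M.rot.SameCycle x y :=
  Quotient.eq

theorem vertexOf_rot_inv (x : M.Dart) : M.vertexOf (M.rot⁻¹ x) = M.vertexOf x := by
  rw [← M.vertexOf_rot, rot_rot_inv]

theorem two_mul_numCycles_rev : 2 * numCycles M.rev = Nat.card M.Dart := by
  have := two_mul_numClasses_involutive (f := M.rev) M.rev_rev
  have h0 : IsEmpty {x // M.rev x = x} := ⟨fun x => M.rev_ne _ x.2⟩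
  rwa [Nat.card_of_isEmpty (α := {x // M.rev x = x}), add_zero] at this

theorem eulerChar_eq :
    M.eulerChar = numCycles M.rot⁻¹ - numCycles M.rev + numCycles M.facePerm := by
  have h : numCycles M.rot⁻¹ = numCycles M.rot := by
    refine numClasses_congr (fun x y h => ?_) (fun x y h => ?_)
    · exact quot_mk_eq_of_rel (by rw [h, rot_rot_inv])
    · exact quot_mk_eq_of_rel (by rw [h, rot_inv_rot])
  rw [eulerChar, h, ← card_quotient_sameCycle, ← card_quotient_sameCycle,
    ← card_quotient_sameCycle]

variable {M}

theorem IsConnected.induction (h : M.IsConnected) {p : M.Dart → Prop}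
    (h1 : ∀ x, p (M.rot x) ↔ p x) (h2 : ∀ x, p (M.rev x) ↔ p x) {x : M.Dart} (hx : p x)
    (y : M.Dart) : p y := by
  have key : p x ↔ p y := by
    have h := h x y
    clear hx
    induction h with
    | rel a b h => rcases h with rfl | rfl; exacts [(h1 a).symm, (h2 a).symm]
    | refl a => rfl
    | symm a b _ ih => exact ih.symm
    | trans a b c _ _ ih1 ih2 => exact ih1.trans ih2
  exact key.1 hx

/-- The cycles of `facePerm * rev` are the vertices and connectedness gives one orbit, so the genus
formula reads 2 − χ. -/
theorem IsSphere.twiceGenus_eq (h : M.IsSphere) [Nonempty M.Dart] :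
    twiceGenus M.facePerm M.rev = 0 := by
  have h1 : numOrbits M.facePerm M.rev = 1 := by
    let r : M.Dart → M.Dart → Prop := fun x y => y = M.facePerm x ∨ y = M.rev x
    obtain ⟨x⟩ := ‹Nonempty M.Dart›
    have hrev : ∀ z, Quot.mk r (M.rev z) = Quot.mk r z := fun z => quot_mk_eq_of_rel (Or.inr rfl)
    have hrot : ∀ z, Quot.mk r (M.rot z) = Quot.mk r z := fun z => by
      rw [← hrev (M.rot z)]
      have : Quot.mk r (M.facePerm (M.rev (M.rot z))) = Quot.mk r (M.rev (M.rot z)) :=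
        quot_mk_eq_of_rel (Or.inl rfl)
      rw [← this, facePerm_rev, rot_inv_rot]
    have : Subsingleton (Quot r) := ⟨by
      have key : ∀ y, Quot.mk r y = Quot.mk r x :=
        h.1.induction (fun z => by rw [hrot]) (fun z => by rw [hrev]) rfl
      rintro ⟨y⟩ ⟨z⟩
      exact (key y).trans (key z).symm⟩
    have : Nonempty (Quot r) := ⟨Quot.mk r x⟩
    exact Nat.card_unique
  have h2 := M.two_mul_numCycles_rev
  have h3 := M.eulerChar_eq
  rw [h.2] at h3
  rw [twiceGenus, facePerm_mul_rev, h1]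
  omega

end CombMap

/-! ### The darts around a crossing or a strand point -/

namespace LinkDiagram

open Equiv

variable {D : LinkDiagram.{u}}

theorem AtCrossing.of_sameCycle {x y : D.Dart} (hx : D.AtCrossing x)
    (h : D.rot.SameCycle x y) : D.AtCrossing y := by
  have h4 : D.degIn D.proj y = 4 := by
    rw [← hx.2]
    unfold CombMap.degIn
    congr 1; ext z
    exact and_congr_left fun _ => ⟨h.trans, h.symm.trans⟩
  rcases D.valence x hx.1 with h2 | ⟨_, h⟩
  · rw [hx.2] at h2; omega
  · exact ⟨h y ‹_›, h4⟩

theorem AtCrossing.rot {x : D.Dart} (hx : D.AtCrossing x) : D.AtCrossing (D.rot x) :=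
  hx.of_sameCycle (Perm.SameCycle.refl _ _).apply_right

theorem AtCrossing.rot_inv {x : D.Dart} (hx : D.AtCrossing x) : D.AtCrossing (D.rot⁻¹ x) :=
  hx.of_sameCycle ⟨-1, by simp⟩

theorem AtCrossing.rot_mem_overDarts {x : D.Dart} (hx : D.AtCrossing x) :
    D.rot x ∈ D.overDarts ↔ x ∉ D.overDarts := D.rot_mem_overDarts x hx.1 hx.2

theorem AtCrossing.rot_inv_mem_overDarts {x : D.Dart} (hx : D.AtCrossing x) :
    D.rot⁻¹ x ∈ D.overDarts ↔ x ∉ D.overDarts := by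
  have := hx.rot_inv.rot_mem_overDarts
  rw [D.rot_rot_inv] at this
  tauto

theorem AtCrossing.rot_ne {x : D.Dart} (hx : D.AtCrossing x) : D.rot x ≠ x := by
  intro h
  have := hx.rot_mem_overDarts
  rw [h] at this
  tauto

theorem AtCrossing.ncard_eq {x : D.Dart} (hx : D.AtCrossing x) :
    {y | D.rot.SameCycle x y}.ncard = 4 := by
  rw [← hx.2, CombMap.degIn]
  congr 1; ext y
  exact ⟨fun h => ⟨h, (hx.of_sameCycle h).1⟩, fun h => h.1⟩

theorem AtCrossing.exists_pow {x y : D.Dart} (hx : D.AtCrossing x) (h : D.rot.SameCycle x y) :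
    ∃ i < 4, (D.rot ^ i) x = y := by
  classical
  have := Fintype.ofFinite D.Dart
  have hc : (D.rot.cycleOf x).support.card = 4 := by
    rw [← hx.ncard_eq, ← Set.ncard_coe_finset]
    congr 1; ext y
    rw [SetLike.mem_coe, Perm.mem_support_cycleOf_iff, Set.mem_ofPred_eq, Perm.mem_support]
    exact ⟨fun h => h.1, fun h => ⟨h, hx.rot_ne⟩⟩
  obtain ⟨i, hi, e⟩ := h.exists_pow_eq_of_mem_support (Perm.mem_support.2 hx.rot_ne)
  exact ⟨i, hc ▸ hi, e⟩

theorem AtCrossing.eq_or {x y : D.Dart} (hx : D.AtCrossing x) (h : D.rot.SameCycle x y) :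
    y = x ∨ y = D.rot x ∨ y = D.rot (D.rot x) ∨ y = D.rot (D.rot (D.rot x)) := by
  obtain ⟨i, hi, rfl⟩ := hx.exists_pow h
  interval_cases i <;> simp [pow_succ]

theorem AtCrossing.rot_rot_ne {x : D.Dart} (hx : D.AtCrossing x) : D.rot (D.rot x) ≠ x := by
  intro h
  have h1 : {y | D.rot.SameCycle x y} ⊆ {x, D.rot x} := by
    intro y hy
    rcases hx.eq_or hy with rfl | rfl | rfl | rfl <;> simp [h]
  have h2 := Set.ncard_le_ncard h1 (Set.toFinite _)
  rw [hx.ncard_eq] at h2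
  have := Set.ncard_insert_le x {D.rot x}
  rw [Set.ncard_singleton] at this
  omega

/-- The fourth rotation is one of the four darts at the crossing. Any value other than `x` would
make a shorter rotation fix a dart, against the alternation of over and under or against the number
of darts. -/
theorem AtCrossing.rot_four {x : D.Dart} (hx : D.AtCrossing x) :
    D.rot (D.rot (D.rot (D.rot x))) = x := by
  have h : D.rot.SameCycle x (D.rot (D.rot (D.rot (D.rot x)))) :=
    (Perm.SameCycle.refl _ _).apply_right.apply_right.apply_right.apply_right
  rcases hx.eq_or h with h | h | h | h
  · exact h
  · have h := D.rot.injective h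
    have := hx.rot.rot_mem_overDarts
    have := hx.rot_mem_overDarts
    have := hx.rot.rot.rot_mem_overDarts
    rw [h] at this
    tauto
  · exact (hx.rot_rot_ne (D.rot.injective (D.rot.injective h))).elim
  · exact (hx.rot_ne (D.rot.injective (D.rot.injective (D.rot.injective h)))).elim

theorem eq_of_not_atCrossing {x y z : D.Dart} (hx : x ∈ D.proj) (hc : ¬ D.AtCrossing x)
    (hy : y ∈ D.proj) (hz : z ∈ D.proj) (hxy : D.rot.SameCycle x y) (hxz : D.rot.SameCycle x z)
    (h1 : y ≠ x) (h2 : z ≠ x) : y = z := by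
  by_contra h
  have hs : ({x, y, z} : Set D.Dart) ⊆ {w | D.rot.SameCycle x w ∧ w ∈ D.proj} := by
    rintro w (rfl | rfl | rfl)
    exacts [⟨Perm.SameCycle.refl _ _, hx⟩, ⟨hxy, hy⟩, ⟨hxz, hz⟩]
  have h3 := Set.ncard_le_ncard hs (Set.toFinite _)
  rw [Set.ncard_eq_three.2 ⟨x, y, z, h1.symm, h2.symm, h, rfl⟩] at h3
  rcases D.valence x hx with h | ⟨h, _⟩
  · unfold CombMap.degIn at h; omega
  · exact hc ⟨hx, h⟩

theorem exists_ne_of_not_atCrossing {x : D.Dart} (hx : x ∈ D.proj) (hc : ¬ D.AtCrossing x) :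
    ∃ y ∈ D.proj, D.rot.SameCycle x y ∧ y ≠ x := by
  by_contra! h
  have hs : {w | D.rot.SameCycle x w ∧ w ∈ D.proj} ⊆ {x} := fun w hw => by
    exact h w hw.2 hw.1
  have h3 := Set.ncard_le_ncard hs (Set.toFinite _)
  rw [Set.ncard_singleton] at h3
  rcases D.valence x hx with h | ⟨h, _⟩
  · unfold CombMap.degIn at h; omega
  · exact hc ⟨hx, h⟩

theorem Through.symm {x y : D.Dart} (h : D.Through x y) : D.Through y x :=
  ⟨h.2.1, h.1, fun hy => h.2.2.1 (hy.of_sameCycle h.2.2.2.1.symm), h.2.2.2.1.symm,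
    h.2.2.2.2.symm⟩

theorem Through.unique {x y z : D.Dart} (h : D.Through x y) (h' : D.Through x z) : y = z :=
  eq_of_not_atCrossing h.1 h.2.2.1 h.2.1 h'.2.1 h.2.2.2.1 h'.2.2.2.1 h.2.2.2.2.symm
    h'.2.2.2.2.symm

variable (D) in
/-- The next dart of the projection at the same vertex in clockwise order. -/
def next (x : D.proj) : D.proj := firstReturn D.rot⁻¹ x

theorem slide_next (x : D.proj) : Quot.mk (SlideRel D.proj D.rot⁻¹) (D.next x).1 =
    Quot.mk (SlideRel D.proj D.rot⁻¹) (D.rot⁻¹ x.1) := slide_firstReturn _ x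

theorem next_of_atCrossing {x : D.proj} (h : D.AtCrossing x.1) : (D.next x).1 = D.rot⁻¹ x.1 :=
  firstReturn_eq_of_mem _ x h.rot_inv.1

theorem through_next {x : D.proj} (h : ¬ D.AtCrossing x.1) : D.Through x.1 (D.next x).1 := by
  refine ⟨x.2, (D.next x).2, h, (sameCycle_firstReturn D.rot⁻¹ x).of_inv, fun e => ?_⟩
  obtain ⟨y, hy, hxy, hne⟩ := exists_ne_of_not_atCrossing x.2 h
  exact hne (eq_of_firstReturn_eq _ x (Subtype.ext e.symm) hy hxy.inv)

theorem Through.eq_next {x y : D.Dart} (h : D.Through x y) : (D.next ⟨x, h.1⟩).1 = y :=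
  (through_next (x := ⟨x, h.1⟩) h.2.2.1).unique h

end LinkDiagram

/-! ### Double covers and the checkerboard colouring -/

open Equiv in
theorem two_mul_numCycles_le_cover {X : Type*} [Finite X] (σ : Perm X) (τ : Perm (X × Bool))
    (f : X → Bool) (h : ∀ z, τ z = (σ z.1, xor z.2 (xor (f z.1) (f (σ z.1))))) :
    2 * numCycles σ ≤ numCycles τ := by
  -- The function `f` trivializes the double cover: the sheet number corrected by `f` is constant
  -- along cycles of `τ`, so every cycle of `σ` has two lifts.
  let q : Quot (fun z w => w = τ z) → Quot (fun x y => y = σ x) × Bool :=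
    Quot.lift (fun z => (Quot.mk _ z.1, xor z.2 (f z.1))) (by
      rintro z w rfl
      rw [h]
      refine Prod.ext (Quot.sound rfl) ?_
      cases z.2 <;> cases f z.1 <;> cases f (σ z.1) <;> rfl)
  have hq : Function.Surjective q := by
    rintro ⟨c, b⟩
    induction c using Quot.ind with | mk x => ?_
    refine ⟨Quot.mk _ (x, xor b (f x)), Prod.ext rfl ?_⟩
    change xor (xor b (f x)) (f x) = b
    cases b <;> cases f x <;> rfl
  have := Nat.card_le_card_of_surjective q hq
  rw [Nat.card_prod, Nat.card_eq_fintype_card (α := Bool), Fintype.card_bool, mul_comm] at this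
  exact this

namespace LinkDiagram

open Equiv

variable (D : LinkDiagram.{u})

/-- Around each vertex, the corners can be coloured so that the colour changes exactly at the
projection. -/
theorem exists_corner_colouring :
    ∃ f : D.Dart → Prop, ∀ x, (f (D.rot⁻¹ x) ↔ f x) ↔ x ∉ D.proj := by
  classical
  have hp : ∀ v : D.Vertex, ∃ p : D.Dart, ∀ x ∈ D.proj, D.vertexOf x = v →
      p ∈ D.proj ∧ D.vertexOf p = v := by
    intro v
    by_cases h : ∃ x ∈ D.proj, D.vertexOf x = v
    · obtain ⟨p, hp, e⟩ := h
      exact ⟨p, fun _ _ _ => ⟨hp, e⟩⟩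
    · push Not at h
      obtain ⟨x⟩ := v
      exact ⟨x, fun y hy e => (h y hy e).elim⟩
  choose p hp using hp
  let mk := Quot.mk (SlideRel D.proj D.rot⁻¹)
  -- The value at `x` colours the corner counterclockwise of `x`. At a crossing the over/under
  -- labels alternate already; at a strand point one colour consists of the corners that slide
  -- clockwise to the chosen projection dart `p`.
  refine ⟨fun x => (D.AtCrossing x ∧ x ∈ D.overDarts) ∨
    (¬ D.AtCrossing x ∧ mk x = mk (p (D.vertexOf x))), fun x => ?_⟩
  have hv : D.vertexOf (D.rot⁻¹ x) = D.vertexOf x := D.vertexOf_rot_inv x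
  have hc' : D.AtCrossing (D.rot⁻¹ x) ↔ D.AtCrossing x :=
    ⟨fun h => by simpa [D.rot_rot_inv] using h.rot, fun h => h.rot_inv⟩
  simp only [hv, hc']
  by_cases hc : D.AtCrossing x
  · have := hc.rot_inv_mem_overDarts
    have := hc.1
    tauto
  · simp only [hc, false_and, not_false_eq_true, true_and, false_or]
    by_cases hx : x ∈ D.proj
    · simp only [hx, not_true_eq_false, iff_false]
      obtain ⟨hpP, hpv⟩ := hp _ x hx rfl
      have ht := through_next (x := ⟨x, hx⟩) hc
      have hs : mk (D.next ⟨x, hx⟩).1 = mk (D.rot⁻¹ x) := slide_next _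
      rw [← hs]
      by_cases hxp : x = p (D.vertexOf x)
      · rw [← hxp]
        intro h
        exact ht.2.2.2.2 (slide_injOn ht.2.1 hx (h.2 rfl)).symm
      · have e : (D.next ⟨x, hx⟩).1 = p (D.vertexOf x) :=
          eq_of_not_atCrossing hx hc ht.2.1 hpP ht.2.2.2.1
            (D.vertexOf_eq_iff.1 hpv.symm) ht.2.2.2.2.symm (Ne.symm hxp)
        rw [e]
        intro h
        exact hxp (slide_injOn hx hpP (h.1 rfl))
    · simp only [hx, not_false_eq_true, iff_true]
      rw [show mk (D.rot⁻¹ x) = mk x from slide_mk hx]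

/-- The faces can be coloured in two colours so that the colour changes exactly across the
projection. -/
theorem exists_checkerboard [Nonempty D.Dart] : ∃ col : D.Dart → Prop,
    (∀ x, col (D.facePerm x) ↔ col x) ∧ ∀ x, (col (D.rev x) ↔ col x) ↔ x ∉ D.proj := by
  classical
  obtain ⟨f, hf⟩ := D.exists_corner_colouring
  let P : D.Dart → Bool := fun x => decide (x ∈ D.proj)
  have hPrev : ∀ x, P (D.rev x) = P x := fun x => by
    refine decide_eq_decide.2 ⟨fun h => ?_, D.rev_mem_proj x⟩
    simpa [D.rev_rev] using D.rev_mem_proj _ h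
  -- Double cover of the sphere in which crossing the projection changes the sheet. Faces lift twice
  -- trivially, vertices because of the corner colouring.
  let a : D.Dart × Bool → D.Dart × Bool := fun z => (D.rev z.1, xor z.2 (P z.1))
  have ha : Function.Involutive a := fun z => by
    refine Prod.ext (D.rev_rev _) ?_
    change xor (xor z.2 (P z.1)) (P (D.rev z.1)) = z.2
    rw [hPrev]; cases z.2 <;> cases P z.1 <;> rfl
  let α : Perm (D.Dart × Bool) := ha.toPerm
  let φ : Perm (D.Dart × Bool) := D.facePerm.prodCongr (Equiv.refl Bool)
  have c1 : 2 * numCycles D.facePerm ≤ numCycles φ :=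
    two_mul_numCycles_le_cover _ _ (fun _ => false) fun z => by
      simp [φ, Prod.map]
  have c2 : 2 * numCycles D.rot⁻¹ ≤ numCycles (φ * α) := by
    refine two_mul_numCycles_le_cover _ _ (fun x => decide (f x)) fun z => ?_
    refine Prod.ext (D.facePerm_rev z.1) ?_
    change xor z.2 (P z.1) = _
    congr 1
    have := hf z.1
    by_cases h1 : z.1 ∈ D.proj <;> by_cases h2 : f z.1 <;> by_cases h3 : f (D.rot⁻¹ z.1) <;>
      simp_all [P]
  have c3 : 2 * numCycles α = Nat.card (D.Dart × Bool) := by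
    have := two_mul_numClasses_involutive ha
    have h0 : IsEmpty {z // a z = z} := ⟨fun z => D.rev_ne _ (congrArg Prod.fst z.2)⟩
    rwa [Nat.card_of_isEmpty (α := {z // a z = z}), add_zero] at this
  have c4 := twiceGenus_nonneg φ α
  have c6 := D.isSphere.2
  rw [D.eulerChar_eq] at c6
  have c7 := D.two_mul_numCycles_rev
  rw [Nat.card_prod, Nat.card_eq_fintype_card (α := Bool), Fintype.card_bool] at c3
  rw [twiceGenus, Nat.card_prod, Nat.card_eq_fintype_card (α := Bool), Fintype.card_bool] at c4
  -- The cover has Euler characteristic at least 4, so nonnegativity of the genus forces it to be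
  -- disconnected.
  have c8 : 2 ≤ numOrbits φ α := by push_cast at c4; omega
  let r : D.Dart × Bool → D.Dart × Bool → Prop := fun z w => w = φ z ∨ w = α z
  have rφ : ∀ x b, Quot.mk r (D.facePerm x, b) = Quot.mk r (x, b) :=
    fun x b => quot_mk_eq_of_rel (Or.inl rfl)
  have rα : ∀ x b, Quot.mk r (D.rev x, xor b (P x)) = Quot.mk r (x, b) :=
    fun x b => quot_mk_eq_of_rel (Or.inr rfl)
  obtain ⟨x₀⟩ := ‹Nonempty D.Dart›
  -- Every point of the cover is connected to one of the two lifts of `x₀`; being disconnected, the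
  -- cover consists of two sheets, and one of them defines the colour.
  have key : ∀ x, ∃ b, ∀ c, Quot.mk r (x, c) = Quot.mk r (x₀, xor c b) := by
    have hrev : ∀ x, (∃ b, ∀ c, Quot.mk r (x, c) = Quot.mk r (x₀, xor c b)) →
        ∃ b, ∀ c, Quot.mk r (D.rev x, c) = Quot.mk r (x₀, xor c b) := by
      rintro x ⟨b, hb⟩
      refine ⟨xor (P x) b, fun c => ?_⟩
      have := rα x (xor c (P x))
      rw [Bool.xor_assoc, Bool.xor_self, Bool.xor_false] at this
      rw [this, hb, Bool.xor_assoc]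
    have hrev' : ∀ x, (∃ b, ∀ c, Quot.mk r (D.rev x, c) = Quot.mk r (x₀, xor c b)) ↔
        ∃ b, ∀ c, Quot.mk r (x, c) = Quot.mk r (x₀, xor c b) := fun x =>
      ⟨fun h => by simpa only [D.rev_rev] using hrev _ h, hrev x⟩
    refine D.isSphere.1.induction (p := fun x => ∃ b, ∀ c, Quot.mk r (x, c) =
      Quot.mk r (x₀, xor c b)) (x := x₀) (fun x => ?_) hrev' ⟨false, fun c => by simp⟩
    rw [← hrev']
    have e : x = D.facePerm (D.rev (D.rot x)) := by rw [D.facePerm_rev, D.rot_inv_rot]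
    conv_rhs => rw [e]
    simp only [rφ]
  have hne : Quot.mk r (x₀, true) ≠ Quot.mk r (x₀, false) := by
    intro h
    have h' : ∀ z, Quot.mk r z = Quot.mk r (x₀, true) := by
      rintro ⟨x, c⟩
      obtain ⟨b, hb⟩ := key x
      rw [hb]
      cases xor c b
      · exact h.symm
      · rfl
    have : Subsingleton (Quot r) := ⟨by rintro ⟨z⟩ ⟨w⟩; exact (h' z).trans (h' w).symm⟩
    have : Nat.card (Quot r) ≤ 1 := Finite.card_le_one_iff_subsingleton.2 this
    exact absurd (c8.trans this) (by norm_num)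
  refine ⟨fun x => Quot.mk r (x, true) = Quot.mk r (x₀, true), fun x => by
    change Quot.mk r _ = _ ↔ _
    rw [rφ], fun x => ?_⟩
  change (Quot.mk r _ = _ ↔ Quot.mk r _ = _) ↔ _
  obtain ⟨b, hb⟩ := key x
  have h1 := rα x true
  have h2 := rα x false
  have h3 := hb true
  have h4 := hb false
  by_cases hx : x ∈ D.proj
  · simp only [P, hx, decide_true, Bool.xor_self, Bool.false_xor] at h1 h2
    rw [h2, h3, h4]
    cases b <;> simp [hne.symm, hx]
  · simp only [P, hx, decide_false, Bool.xor_false] at h1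
    rw [h1]
    simp [hx]

end LinkDiagram

/-! ### The gluing permutation and planarity of the cut surface -/

namespace LinkDiagram

open Equiv

variable {D : LinkDiagram.{u}} {K : Set D.Vertex}

theorem atCrossing_of_mem (hK : K ⊆ D.crossings) {x : D.Dart} (hx : D.vertexOf x ∈ K) :
    D.AtCrossing x := by
  obtain ⟨y, hy, e⟩ := hK hx
  exact hy.of_sameCycle (D.vertexOf_eq_iff.1 e)

open Classical in
variable (D K) in
/-- How the sides of the faces are glued in the surface: edges outside of the projection are glued
as usual, and the bands connect opposite corners at the vertices in `K`. -/
def glue (x : D.Dart) : D.Dart :=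
  if x ∉ D.proj then D.rev x else if D.vertexOf x ∈ K then D.rot (D.rot x) else x

theorem glue_of_notMem {x : D.Dart} (h : x ∉ D.proj) : D.glue K x = D.rev x := if_pos h

theorem glue_of_mem (hK : K ⊆ D.crossings) {x : D.Dart} (h : D.vertexOf x ∈ K) :
    D.glue K x = D.rot (D.rot x) := by
  rw [glue, if_neg (not_not.2 (atCrossing_of_mem hK h).1), if_pos h]

theorem glue_of_vertexOf_notMem {x : D.Dart} (hx : x ∈ D.proj) (h : D.vertexOf x ∉ K) :
    D.glue K x = x := by
  rw [glue, if_neg (not_not.2 hx), if_neg h]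

theorem rev_mem_proj_iff {x : D.Dart} : D.rev x ∈ D.proj ↔ x ∈ D.proj :=
  ⟨fun h => by simpa [D.rev_rev] using D.rev_mem_proj _ h, D.rev_mem_proj x⟩

theorem vertexOf_rot_rot (x : D.Dart) : D.vertexOf (D.rot (D.rot x)) = D.vertexOf x := by
  rw [D.vertexOf_rot, D.vertexOf_rot]

theorem glue_mem_proj_iff (hK : K ⊆ D.crossings) {x : D.Dart} :
    D.glue K x ∈ D.proj ↔ x ∈ D.proj := by
  by_cases hx : x ∈ D.proj
  · by_cases h : D.vertexOf x ∈ K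
    · rw [glue_of_mem hK h]
      exact iff_of_true (atCrossing_of_mem hK h).rot.rot.1 hx
    · rw [glue_of_vertexOf_notMem hx h]
  · rw [glue_of_notMem hx, rev_mem_proj_iff]

theorem glue_involutive (hK : K ⊆ D.crossings) : Function.Involutive (D.glue K) := by
  intro x
  by_cases hx : x ∈ D.proj
  · by_cases h : D.vertexOf x ∈ K
    · rw [glue_of_mem hK h, glue_of_mem hK (by rwa [vertexOf_rot_rot]),
        (atCrossing_of_mem hK h).rot_four]
    · rw [glue_of_vertexOf_notMem hx h, glue_of_vertexOf_notMem hx h]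
  · rw [glue_of_notMem hx, glue_of_notMem (by rwa [rev_mem_proj_iff]), D.rev_rev]

/-- `glue` as a permutation. -/
def gluePerm (hK : K ⊆ D.crossings) : Perm D.Dart := (glue_involutive hK).toPerm

theorem gluePerm_apply (hK : K ⊆ D.crossings) (x : D.Dart) : gluePerm hK x = D.glue K x := rfl

section Colour

variable {B : Set D.Dart} (hφ : ∀ x, D.facePerm x ∈ B ↔ x ∈ B)
  (hB : ∀ x, (D.rev x ∈ B ↔ x ∈ B) ↔ x ∉ D.proj)

include hφ hB

theorem rot_inv_mem_colour {x : D.Dart} (hx : x ∈ D.proj) : D.rot⁻¹ x ∈ B ↔ x ∉ B := by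
  rw [← D.facePerm_rev, hφ]
  have := hB x
  tauto

theorem rot_mem_colour {x : D.Dart} (hx : D.AtCrossing x) : D.rot x ∈ B ↔ x ∉ B := by
  have := rot_inv_mem_colour hφ hB hx.rot.1
  rw [D.rot_inv_rot] at this
  tauto

theorem glue_mem_colour (hK : K ⊆ D.crossings) (x : D.Dart) : D.glue K x ∈ B ↔ x ∈ B := by
  by_cases hx : x ∈ D.proj
  · by_cases h : D.vertexOf x ∈ K
    · have hc := atCrossing_of_mem hK h
      rw [glue_of_mem hK h, rot_mem_colour hφ hB hc.rot, rot_mem_colour hφ hB hc, not_not]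
    · rw [glue_of_vertexOf_notMem hx h]
  · rw [glue_of_notMem hx]
    exact (hB x).2 hx

/-- The surface made from the faces of one colour has genus zero. -/
theorem twiceGenus_colour_le [Nonempty D.Dart] (hK : K ⊆ D.crossings) (γ : Perm D.Dart)
    (h1 : ∀ x ∈ B, γ x = D.glue K x) (h2 : ∀ x ∉ B, γ x = x) : twiceGenus D.facePerm γ ≤ 0 := by
  classical
  have := Fintype.ofFinite D.Dart
  -- Only the bands of the colour `B`: one pair of opposite corners at each vertex of `K`.
  let k : D.Dart → D.Dart := fun x => if x ∈ B ∧ D.vertexOf x ∈ K then D.rot (D.rot x) else x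
  have k1 : ∀ x, x ∈ B → D.vertexOf x ∈ K → k x = D.rot (D.rot x) :=
    fun x h h' => if_pos ⟨h, h'⟩
  have k2 : ∀ x, x ∉ B → k x = x := fun x h => if_neg fun h' => h h'.1
  have k3 : ∀ x, D.vertexOf x ∉ K → k x = x := fun x h => if_neg fun h' => h h'.2
  have kr : ∀ x, D.vertexOf x ∈ K → (D.rot (D.rot x) ∈ B ↔ x ∈ B) := fun x hx => by
    rw [← glue_of_mem hK hx, glue_mem_colour hφ hB hK]
  have hk : Function.Involutive k := by
    intro x
    by_cases hx : x ∈ B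
    · by_cases h : D.vertexOf x ∈ K
      · rw [k1 x hx h, k1 _ ((kr x h).2 hx) (by rwa [vertexOf_rot_rot]),
          (atCrossing_of_mem hK h).rot_four]
      · rw [k3 x h, k3 x h]
    · rw [k2 x hx, k2 x hx]
  have k4 : ∀ x, k x ≠ x → x ∈ B ∧ D.vertexOf x ∈ K := fun x hx => by
    by_contra h
    exact hx (if_neg h)
  let κ : Perm D.Dart := hk.toPerm
  -- Start from the whole sphere: the cycles of `facePerm * rev` are the vertices, each carrying at
  -- most one pair of `κ`.
  have s1 : twiceGenus D.facePerm (D.rev * κ) ≤ 0 := by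
    rw [← D.isSphere.twiceGenus_eq]
    refine twiceGenus_mul_involutive_le _ _ κ hk (fun x hx => ?_) fun x y hx hy h => ?_
    · obtain ⟨h, h'⟩ := k4 x hx
      rw [D.facePerm_mul_rev, show κ x = _ from k1 x h h']
      exact (Perm.SameCycle.refl D.rot x).apply_right.apply_right.inv
    · obtain ⟨hxB, hxK⟩ := k4 x hx
      obtain ⟨hyB, -⟩ := k4 y hy
      rw [D.facePerm_mul_rev] at h
      rw [show κ x = _ from k1 x hxB hxK]
      have hc := atCrossing_of_mem hK hxK
      rcases hc.eq_or h.of_inv with e | e | e | e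
      · exact Or.inl e
      · rw [e, rot_mem_colour hφ hB hc] at hyB
        exact (hyB hxB).elim
      · exact Or.inr e
      · rw [e, rot_mem_colour hφ hB hc.rot.rot, kr x hxK] at hyB
        exact (hyB hxB).elim
  -- Next unglue the darts of the other colour and those at ordinary places of the projection.
  refine le_trans (twiceGenus_bypass_le _ (D.rev * κ) γ
    (Finset.univ.filter fun x => ¬ (x ∈ B ∧ (x ∉ D.proj ∨ D.vertexOf x ∈ K))) ?_ ?_) s1
  · intro y hy
    simp only [Finset.mem_filter, Finset.mem_univ, true_and] at hy
    by_cases hyB : y ∈ B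
    · rw [h1 y hyB, glue_of_vertexOf_notMem] <;> tauto
    · exact h2 y hyB
  · intro x hx
    simp only [Finset.mem_filter, Finset.mem_univ, true_and, not_not] at hx ⊢
    obtain ⟨hxB, hx⟩ := hx
    rw [Perm.mul_apply, h1 x hxB]
    rcases hx with hx | hx
    · left
      have hxK : D.vertexOf x ∉ K := fun h => hx (atCrossing_of_mem hK h).1
      rw [show κ x = x from k3 x hxK, glue_of_notMem hx]
      exact ⟨⟨((hB x).2 hx).2 hxB, Or.inl (by rwa [rev_mem_proj_iff])⟩, rfl⟩
    -- Here `rev * κ` first reaches `rev (rot (rot x))`, of the other colour and hence removed, and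
    -- from there `rot (rot x)`, which is the end of the band.
    · right
      have hc := atCrossing_of_mem hK hx
      have hr := (kr x hx).2 hxB
      have hn : D.rev (D.rot (D.rot x)) ∉ B := by
        have := hB (D.rot (D.rot x))
        have := hc.rot.rot.1
        tauto
      rw [show κ x = _ from k1 x hxB hx, Perm.mul_apply, show κ _ = _ from k2 _ hn, D.rev_rev,
        glue_of_mem hK hx]
      exact ⟨fun h => hn h.1, ⟨hr, Or.inr (by rwa [vertexOf_rot_rot])⟩, rfl⟩

end Colour

/-- The gluing respects the colouring, so the genus is the sum over the two colours, each of which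
is planar. The two colours together need not be planar in the sphere, since the two bands of a
dealternator would intersect. -/
theorem twiceGenus_gluePerm [Nonempty D.Dart] (hK : K ⊆ D.crossings) :
    twiceGenus D.facePerm (gluePerm hK) = 0 := by
  classical
  obtain ⟨col, hφ, hB⟩ := D.exists_checkerboard
  refine le_antisymm ?_ (twiceGenus_nonneg _ _)
  have part : ∀ C : Set D.Dart, (∀ x, D.glue K x ∈ C ↔ x ∈ C) → ∃ γ : Perm D.Dart,
      (∀ x ∈ C, γ x = D.glue K x) ∧ ∀ x ∉ C, γ x = x := by
    intro C hC
    let f : D.Dart → D.Dart := fun x => if x ∈ C then D.glue K x else x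
    have f1 : ∀ x ∈ C, f x = D.glue K x := fun x h => if_pos h
    have f2 : ∀ x ∉ C, f x = x := fun x h => if_neg h
    have hf : Function.Involutive f := by
      intro x
      by_cases hx : x ∈ C
      · rw [f1 x hx, f1 _ ((hC x).2 hx), glue_involutive hK]
      · rw [f2 x hx, f2 x hx]
    exact ⟨hf.toPerm, f1, f2⟩
  let B : Set D.Dart := {x | col x}
  have hφ' : ∀ x, D.facePerm x ∈ Bᶜ ↔ x ∈ Bᶜ := fun x => not_congr (hφ x)
  have hB' : ∀ x, (D.rev x ∈ Bᶜ ↔ x ∈ Bᶜ) ↔ x ∉ D.proj := fun x => by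
    rw [← hB x]; exact not_iff_not
  obtain ⟨γ₁, a1, a2⟩ := part B (glue_mem_colour hφ hB hK)
  obtain ⟨γ₂, b1, b2⟩ := part Bᶜ (glue_mem_colour hφ' hB' hK)
  rw [twiceGenus_eq_add B _ (gluePerm hK) γ₁ γ₂ hφ (glue_mem_colour hφ hB hK) a1 a2 b1
    fun x hx => b2 x (not_not.2 hx)]
  have := twiceGenus_colour_le hφ hB hK γ₁ a1 a2
  have := twiceGenus_colour_le hφ' hB' hK γ₂ b1 b2
  omega

end LinkDiagram

/-! ### Arcs between crossings and the direction of edges -/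

namespace LinkDiagram

open Equiv

section ArcType

variable {D : LinkDiagram.{u}}

theorem arcEnd_iff {x y : D.Dart} : D.ArcEnd x y ↔ (x ∈ D.proj ∧ y = D.rev x) ∨
    ∃ a z, D.ArcEnd x a ∧ D.Through a z ∧ y = D.rev z := by
  constructor
  · rintro (h | ⟨a, z, h, ht⟩)
    · exact Or.inl ⟨h, rfl⟩
    · exact Or.inr ⟨a, z, h, ht, rfl⟩
  · rintro (⟨h, rfl⟩ | ⟨a, z, h, ht, rfl⟩)
    · exact ArcEnd.edge x h
    · exact ArcEnd.extend x a z h ht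

theorem ArcEnd.prepend {x y b : D.Dart} (h : D.ArcEnd y b) (hx : x ∈ D.proj)
    (ht : D.Through (D.rev x) y) : D.ArcEnd x b := by
  induction h with
  | edge => exact ArcEnd.extend x _ y (ArcEnd.edge x hx) ht
  | extend a c _ h' ih => exact ArcEnd.extend x _ _ ih h'

theorem ArcEnd.symm {x y : D.Dart} (h : D.ArcEnd x y) : D.ArcEnd y x := by
  induction h with
  | edge h =>
    have := ArcEnd.edge (D.rev x) (D.rev_mem_proj x h)
    rwa [D.rev_rev] at this
  | extend y z _ h' ih =>
    exact ih.prepend (D.rev_mem_proj z h'.2.1) (by rw [D.rev_rev]; exact h'.symm)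

theorem ArcEnd.trans {w x y : D.Dart} (h : D.ArcEnd w (D.rev x)) (h' : D.ArcEnd x y) :
    D.ArcEnd w y := by
  induction h' with
  | edge => exact h
  | extend y z _ ht ih => exact ArcEnd.extend w _ _ ih ht

theorem ArcEnd.of_extend {w y z : D.Dart} (hw : D.AtCrossing w) (ht : D.Through y z)
    (h : D.ArcEnd w (D.rev z)) : D.ArcEnd w y := by
  rcases arcEnd_iff.1 h with ⟨_, e⟩ | ⟨a, z', h', ht', e⟩
  · rw [D.rev.injective e] at ht
    exact (ht.symm.2.2.1 hw).elim
  · rw [← D.rev.injective e] at ht'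
    rwa [ht.symm.unique ht'.symm]

/-- An arc can be retraced: the partner under `Through` is unique, and the way back stops exactly
when it meets a crossing. -/
theorem ArcEnd.unique {w w' y : D.Dart} (hw : D.AtCrossing w) (hw' : D.AtCrossing w')
    (h : D.ArcEnd w y) (h' : D.ArcEnd w' y) : w = w' := by
  induction h with
  | edge =>
    rcases arcEnd_iff.1 h' with ⟨_, e⟩ | ⟨a, z', -, ht', e⟩
    · exact D.rev.injective e
    · rw [← D.rev.injective e] at ht'
      exact (ht'.symm.2.2.1 hw).elim
  | extend y z _ ht ih => exact ih (h'.of_extend hw' ht)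

/-- In an alternating diagram, the two sides of the projection can be distinguished consistently:
at a crossing, one side lies left of the overcrossing darts and right of the others. -/
theorem IsAlternating.exists_type [Nonempty D.Dart] (h : D.IsAlternating) :
    ∃ T : D.Dart → Prop, (∀ x ∈ D.proj, T (D.rev x) ↔ ¬ T x) ∧
      (∀ x y, D.Through (D.rev x) y → (T y ↔ T x)) ∧
      ∀ x, D.AtCrossing x → (T x ↔ x ∈ D.overDarts) := by
  obtain ⟨col, hφ, hcol⟩ := D.exists_checkerboard
  -- `U` and `V` say that the arc running along `x` comes from an overpass, respectively from an
  -- underpass.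
  let U : D.Dart → Prop := fun x => ∃ w, D.AtCrossing w ∧ w ∈ D.overDarts ∧ D.ArcEnd w (D.rev x)
  let V : D.Dart → Prop := fun x => ∃ w, D.AtCrossing w ∧ w ∉ D.overDarts ∧ D.ArcEnd w (D.rev x)
  have UV : ∀ x, U x → ¬ V x := by
    rintro x ⟨w, hw, ho, ha⟩ ⟨w', hw', ho', ha'⟩
    rw [ha.unique hw hw' ha'] at ho
    exact ho' ho
  have UU : ∀ x, U x → ¬ U (D.rev x) := by
    rintro x ⟨w, hw, ho, ha⟩ ⟨w', hw', ho', ha'⟩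
    rw [D.rev_rev] at ha'
    exact (h w w' hw hw' (ha.trans ha'.symm)).1 ho ho'
  have VV : ∀ x, V x → ¬ V (D.rev x) := by
    rintro x ⟨w, hw, ho, ha⟩ ⟨w', hw', ho', ha'⟩
    rw [D.rev_rev] at ha'
    exact ho ((h w w' hw hw' (ha.trans ha'.symm)).2 ho')
  have hU : ∀ x y, D.Through (D.rev x) y → (U y ↔ U x) := fun x y ht =>
    exists_congr fun w => and_congr_right fun hw => and_congr_right fun _ =>
      ⟨fun ha => ha.of_extend hw ht, fun ha => ArcEnd.extend _ _ _ ha ht⟩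
  have hV : ∀ x y, D.Through (D.rev x) y → (V y ↔ V x) := fun x y ht =>
    exists_congr fun w => and_congr_right fun hw => and_congr_right fun _ =>
      ⟨fun ha => ha.of_extend hw ht, fun ha => ArcEnd.extend _ _ _ ha ht⟩
  have hc : ∀ x y, D.Through (D.rev x) y → (col y ↔ col x) := by
    intro x y ht
    let q : Quot (SlideRel D.proj D.rot⁻¹) → Prop := Quot.lift col (by
      rintro a b ⟨ha, rfl⟩
      rw [← D.facePerm_rev, hφ]
      exact propext ((hcol a).2 ha).symm)
    have e : col (D.next ⟨D.rev x, ht.1⟩).1 = col (D.rot⁻¹ (D.rev x)) := congrArg q (slide_next _)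
    rw [ht.eq_next] at e
    rw [e]
    exact hφ x
  have hU' : ∀ x, D.AtCrossing x → x ∈ D.overDarts → U x :=
    fun x hx ho => ⟨x, hx, ho, ArcEnd.edge x hx.1⟩
  have hV' : ∀ x, D.AtCrossing x → x ∉ D.overDarts → V x :=
    fun x hx ho => ⟨x, hx, ho, ArcEnd.edge x hx.1⟩
  clear_value U V
  -- The arc comes from an overpass or leads to an underpass. When neither direction reaches a
  -- crossing, the checkerboard colour on the left decides.
  refine ⟨fun x => U x ∨ V (D.rev x) ∨
    (¬ U x ∧ ¬ V x ∧ ¬ U (D.rev x) ∧ ¬ V (D.rev x) ∧ col x), fun x hx => ?_, fun x y ht => ?_,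
    fun x hx => ?_⟩
  · have := UV x
    have := UV (D.rev x)
    have := UU x
    have := VV x
    have hc' : col (D.rev x) ↔ ¬ col x := by
      have := hcol x
      tauto
    simp only [D.rev_rev, hc']
    tauto
  · have ht' : D.Through (D.rev (D.rev y)) (D.rev x) := by rw [D.rev_rev]; exact ht.symm
    beta_reduce
    rw [hU x y ht, hV x y ht, hU _ _ ht', hV _ _ ht', hc x y ht]
  · by_cases ho : x ∈ D.overDarts
    · exact iff_of_true (Or.inl (hU' x hx ho)) ho
    · have := hV' x hx ho
      have := UV x
      have := VV x
      tauto

end ArcType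

/-! ### State circles as boundary circles of the cut surface -/

section Circles

variable {D : LinkDiagram.{u}} {K : Set D.Vertex} (hK : K ⊆ D.crossings)

/-- `rev` on the darts of the projection. -/
def revProj (x : D.proj) : D.proj := ⟨D.rev x.1, D.rev_mem_proj _ x.2⟩

theorem revProj_revProj (x : D.proj) : revProj (revProj x) = x := Subtype.ext (D.rev_rev _)

/-- `glue` on the darts of the projection. -/
def glueProj (x : D.proj) : D.proj := ⟨D.glue K x.1, (glue_mem_proj_iff hK).2 x.2⟩

theorem glueProj_glueProj (x : D.proj) : glueProj hK (glueProj hK x) = x :=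
  Subtype.ext (glue_involutive hK _)

/-- The boundary of the surface with the graph cut out: the next dart along the boundary. -/
def boundaryNext (x : D.proj) : D.proj := D.next (revProj (glueProj hK x))

/-- The boundary components of the surface cut along the graph. -/
abbrev BoundaryCircle : Type u := Quot fun x y : D.proj => y = boundaryNext hK x

/-- Off the projection the product is `rot⁻¹`, so its cycles avoiding the projection are the
vertices off the projection; the first return map on the rest is `boundaryNext`. -/
theorem numCycles_facePerm_mul_gluePerm : numCycles (D.facePerm * gluePerm hK) =
    Nat.card (BoundaryCircle hK) + numFree D.proj D.rot⁻¹ := by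
  have e : SlideRel D.proj (D.facePerm * gluePerm hK) = SlideRel D.proj D.rot⁻¹ := by
    ext a b
    refine and_congr_right fun ha => ?_
    rw [Perm.mul_apply, gluePerm_apply, glue_of_notMem ha, D.facePerm_rev]
  have h := numCycles_eq_add_numFree D.proj (D.facePerm * gluePerm hK) (boundaryNext hK) (by
    rw [e]
    exact fun p => slide_next _)
  rw [h, numFree, e]
  rfl

include hK in
theorem Through.glue_left {x y : D.Dart} (h : D.Through x y) : D.glue K x = x :=
  glue_of_vertexOf_notMem h.1 fun hx => h.2.2.1 (atCrossing_of_mem hK hx)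

/-- The circles of a smoothing correspond to the boundary components of one type. -/
theorem card_circle_eq (W : D.Dart → Prop) (Sm : D.Dart → D.Dart → Prop)
    (hrev : ∀ x ∈ D.proj, W (D.rev x) ↔ ¬ W x)
    (hth : ∀ x y, D.Through (D.rev x) y → (W y ↔ W x))
    (hcr : ∀ x, D.AtCrossing x → (W (D.rot x) ↔ ¬ W x))
    (hS : ∀ x y, Sm x y → (D.AtCrossing x ∧ ¬ W x ∧ y = D.glue K (D.rot⁻¹ x)) ∨
      (D.AtCrossing y ∧ ¬ W y ∧ x = D.glue K (D.rot⁻¹ y)))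
    (hS' : ∀ x, D.AtCrossing x → ¬ W x →
      Sm x (D.glue K (D.rot⁻¹ x)) ∨ Sm (D.glue K (D.rot⁻¹ x)) x) :
    ∃ Wq : BoundaryCircle hK → Prop, (∀ p : D.proj, Wq (Quot.mk _ p) ↔ W p.1) ∧
      Nat.card (Quot fun x y : D.proj => y.1 = D.rev x.1 ∨ D.Through x.1 y.1 ∨ Sm x.1 y.1) =
        Nat.card {q // Wq q} := by
  classical
  let c : D.proj → D.proj → Prop := fun x y => y.1 = D.rev x.1 ∨ D.Through x.1 y.1 ∨ Sm x.1 y.1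
  let b : D.proj → D.proj → Prop := fun x y => y = boundaryNext hK x
  have hcr' : ∀ x, D.AtCrossing x → (W (D.rot⁻¹ x) ↔ ¬ W x) := fun x hx => by
    have := hcr _ hx.rot_inv
    rw [D.rot_rot_inv] at this
    tauto
  have hgl : ∀ x : D.proj, W (D.glue K x.1) ↔ W x.1 := fun x => by
    by_cases h : D.vertexOf x.1 ∈ K
    · have hc := atCrossing_of_mem hK h
      rw [glue_of_mem hK h, hcr _ hc.rot, hcr _ hc, not_not]
    · rw [glue_of_vertexOf_notMem x.2 h]
  have hrv : ∀ x : D.proj, W (revProj x).1 ↔ ¬ W x.1 := fun x => hrev _ x.2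
  have hnext : ∀ x : D.proj, W (D.next x).1 ↔ ¬ W x.1 := fun x => by
    by_cases h : D.AtCrossing x.1
    · rw [next_of_atCrossing h, hcr' _ h]
    · rw [← hrv]
      refine hth (D.rev x.1) _ ?_
      rw [D.rev_rev]
      exact through_next h
  have hbn : ∀ x : D.proj, W (boundaryNext hK x).1 ↔ W x.1 := fun x => by
    rw [boundaryNext, hnext, hrv, not_not]
    exact hgl x
  have hb : ∀ x : D.proj, Quot.mk b (glueProj hK (revProj x)) = Quot.mk b (D.next x) := fun x => by
    refine Quot.sound ?_
    change _ = boundaryNext hK _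
    rw [boundaryNext, glueProj_glueProj, revProj_revProj]
  have hb' : ∀ x y : D.proj, D.Through x.1 y.1 →
      Quot.mk b (glueProj hK (revProj y)) = Quot.mk b (glueProj hK x) := fun x y h => by
    rw [hb, show D.next y = x from Subtype.ext h.symm.eq_next,
      show glueProj hK x = x from Subtype.ext (Through.glue_left hK h)]
  have hW : ∀ x y : D.proj, D.Through x.1 y.1 → (W y.1 ↔ ¬ W x.1) := fun x y h => by
    rw [← hrv]
    refine hth _ _ ?_
    change D.Through (D.rev (D.rev x.1)) _
    rwa [D.rev_rev]
  -- Of the two darts of an edge exactly one satisfies `W`. The step `boundaryNext` from `p`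
  -- traverses the dart `glue p`, so the circle along a dart `x` is the class of `glue x`.
  let f : D.proj → Quot b := fun x =>
    if W x.1 then Quot.mk b (glueProj hK x) else Quot.mk b (glueProj hK (revProj x))
  have f1 : ∀ x : D.proj, W x.1 → f x = Quot.mk b (glueProj hK x) := fun x h => if_pos h
  have f2 : ∀ x : D.proj, ¬ W x.1 → f x = Quot.mk b (glueProj hK (revProj x)) :=
    fun x h => if_neg h
  have fS : ∀ x y : D.proj, D.AtCrossing x.1 → ¬ W x.1 → y.1 = D.glue K (D.rot⁻¹ x.1) →
      f x = f y := by
    intro x y hx hWx e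
    have e' : y = glueProj hK (D.next x) := Subtype.ext (by
      rw [e, ← next_of_atCrossing hx]; rfl)
    have hWy : W y.1 := by
      rw [e']
      exact (hgl _).2 ((hnext x).2 hWx)
    rw [f2 x hWx, f1 y hWy, hb, e', glueProj_glueProj]
  let F : Quot c → Quot b := Quot.lift f (by
    rintro x y (h | h | h)
    · have e : y = revProj x := Subtype.ext h
      subst e
      by_cases hx : W x.1
      · rw [f1 x hx, f2 _ (by rw [hrv]; exact not_not.2 hx), revProj_revProj]
      · rw [f2 x hx, f1 _ ((hrv x).2 hx)]
    · by_cases hx : W x.1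
      · rw [f1 x hx, f2 y (by rw [hW x y h]; exact not_not.2 hx), hb' x y h]
      · rw [f2 x hx, f1 y ((hW x y h).2 hx), hb' y x h.symm]
    · rcases hS _ _ h with ⟨h1, h2, h3⟩ | ⟨h1, h2, h3⟩
      · exact fS x y h1 h2 h3
      · exact (fS y x h1 h2 h3).symm)
  let Wq : Quot b → Prop := Quot.lift (fun x => W x.1) (by
    rintro x y rfl
    exact propext (hbn x).symm)
  -- The inverse on circles of type `W`; circles of the other type go to `none`.
  let G : Quot b → Option (Quot c) := Quot.lift
    (fun x => if W x.1 then some (Quot.mk c (glueProj hK x)) else none) (by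
      rintro x y rfl
      by_cases hx : W x.1
      · rw [if_pos hx, if_pos ((hbn x).2 hx)]
        congr 1
        have e1 : Quot.mk c (glueProj hK x) = Quot.mk c (revProj (glueProj hK x)) :=
          Quot.sound (Or.inl rfl)
        have hWa : ¬ W (revProj (glueProj hK x)).1 := by
          rw [hrv]; exact not_not.2 ((hgl x).2 hx)
        rw [e1, boundaryNext]
        generalize revProj (glueProj hK x) = a at hWa
        by_cases ha : D.AtCrossing a.1
        · have e2 : (glueProj hK (D.next a)).1 = D.glue K (D.rot⁻¹ a.1) := by
            rw [← next_of_atCrossing ha]; rfl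
          rcases hS' a.1 ha hWa with h | h <;> rw [← e2] at h
          · exact Quot.sound (Or.inr (Or.inr h))
          · exact quot_mk_eq_of_rel (Or.inr (Or.inr h))
        · have ht := through_next ha
          rw [show glueProj hK (D.next a) = D.next a from
            Subtype.ext (Through.glue_left hK ht.symm)]
          exact Quot.sound (Or.inr (Or.inl ht))
      · rw [if_neg hx, if_neg fun h => hx ((hbn x).1 h)])
  have hFW : ∀ q, Wq (F q) := by
    rintro ⟨x⟩
    change Wq (f x)
    by_cases hx : W x.1
    · rw [f1 x hx]; exact (hgl x).2 hx
    · rw [f2 x hx]; exact (hgl _).2 ((hrv x).2 hx)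
  have hGF : ∀ q, G (F q) = some q := by
    rintro ⟨x⟩
    change G (f x) = _
    by_cases hx : W x.1
    · rw [f1 x hx]
      refine (if_pos ((hgl x).2 hx)).trans ?_
      rw [glueProj_glueProj]
    · rw [f2 x hx]
      refine (if_pos ((hgl _).2 ((hrv x).2 hx))).trans ?_
      rw [glueProj_glueProj]
      exact congrArg some (quot_mk_eq_of_rel (Or.inl rfl))
  refine ⟨Wq, fun p => Iff.rfl, Nat.card_congr (Equiv.ofBijective
    (fun q => (⟨F q, hFW q⟩ : {q // Wq q})) ⟨fun q q' h => ?_, ?_⟩)⟩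
  · have := congrArg (fun z : {q // Wq q} => G z.1) h
    simp only [hGF] at this
    exact Option.some.inj this
  · rintro ⟨q, hq⟩
    induction q using Quot.ind with | mk p => ?_
    refine ⟨Quot.mk c (glueProj hK p), Subtype.ext ?_⟩
    refine (f1 _ ((hgl p).2 hq)).trans ?_
    rw [glueProj_glueProj]

/-- The type `T` is that of the switched diagram. At a vertex of `K` it is opposite to the
over/under labels of `D`, and the band replaces `rot⁻¹` by `rot`; the two changes compensate, so `¬
T` gives the `A`-circles and `T` the `B`-circles everywhere. -/
theorem card_circles [Nonempty D.Dart] (hD : D.IsDealternatorSet K) :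
    Nat.card D.CircleA + Nat.card D.CircleB = Nat.card (BoundaryCircle hD.1) := by
  have hK := hD.1
  have : Nonempty (D.switch K).Dart := ‹Nonempty D.Dart›
  obtain ⟨T, h1, h2, h3⟩ := hD.2.exists_type
  change ∀ x ∈ D.proj, _ at h1
  change ∀ x y, D.Through (D.rev x) y → _ at h2
  have h3 : ∀ x, D.AtCrossing x → (T x ↔ ((D.vertexOf x ∈ K ∧ x ∉ D.overDarts) ∨
    (D.vertexOf x ∉ K ∧ x ∈ D.overDarts))) := h3
  have hcr : ∀ x, D.AtCrossing x → (T (D.rot x) ↔ ¬ T x) := fun x hx => by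
    rw [h3 _ hx.rot, h3 _ hx, D.vertexOf_rot, hx.rot_mem_overDarts]
    tauto
  have g1 : ∀ x, D.AtCrossing x → D.vertexOf x ∈ K → D.glue K (D.rot⁻¹ x) = D.rot x := by
    intro x hx hv
    rw [glue_of_mem hK (by rwa [D.vertexOf_rot_inv]), D.rot_rot_inv]
  have g2 : ∀ x, D.AtCrossing x → D.vertexOf x ∉ K → D.glue K (D.rot⁻¹ x) = D.rot⁻¹ x := by
    intro x hx hv
    exact glue_of_vertexOf_notMem hx.rot_inv.1 (by rwa [D.vertexOf_rot_inv])
  obtain ⟨WA, a1, a2⟩ := card_circle_eq hK (fun x => ¬ T x) D.SmoothA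
    (fun x hx => not_congr (h1 x hx)) (fun x y h => not_congr (h2 x y h))
    (fun x hx => not_congr (hcr x hx)) (by
      rintro x y ⟨hx, ho, rfl⟩
      have hy : D.AtCrossing y := by simpa [D.rot_inv_rot] using hx.rot_inv
      have hT := h3 _ hx
      rw [D.vertexOf_rot] at hT
      by_cases hv : D.vertexOf y ∈ K
      · right
        refine ⟨hy, ?_, (g1 y hy hv).symm⟩
        have := hcr y hy
        tauto
      · left
        refine ⟨hx, by tauto, ?_⟩
        rw [g2 _ hx (by rwa [D.vertexOf_rot]), D.rot_inv_rot])
    (fun x hx hW => by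
      rw [not_not, h3 x hx] at hW
      by_cases hv : D.vertexOf x ∈ K
      · right
        rw [g1 x hx hv]
        exact ⟨hx.rot, hx.rot_mem_overDarts.2 (by tauto), rfl⟩
      · left
        rw [g2 x hx hv]
        exact ⟨hx, by tauto, (D.rot_rot_inv x).symm⟩)
  obtain ⟨WB, b1, b2⟩ := card_circle_eq hK T D.SmoothB h1 h2 hcr (by
      rintro x y ⟨hx, ho, rfl⟩
      have hT := h3 _ hx
      by_cases hv : D.vertexOf x ∈ K
      · left
        exact ⟨hx, by tauto, (g1 x hx hv).symm⟩
      · right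
        refine ⟨hx.rot, ?_, ?_⟩
        · rw [hcr x hx]; tauto
        · rw [g2 _ hx.rot (by rwa [D.vertexOf_rot]), D.rot_inv_rot])
    (fun x hx hW => by
      rw [h3 x hx] at hW
      by_cases hv : D.vertexOf x ∈ K
      · left
        rw [g1 x hx hv]
        exact ⟨hx, by tauto, rfl⟩
      · right
        rw [g2 x hx hv]
        exact ⟨hx.rot_inv, hx.rot_inv_mem_overDarts.2 (by tauto), (D.rot_rot_inv x).symm⟩)
  have hc : ∀ q, WB q ↔ ¬ WA q := by
    rintro ⟨p⟩
    rw [a1, b1, not_not]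
  have e : Nat.card {q // WB q} = Nat.card {q // ¬ WA q} :=
    Nat.card_congr (Equiv.subtypeEquivRight hc)
  classical
  rw [CircleA, CircleB, a2, b2, e, ← Nat.card_sum]
  exact Nat.card_congr (Equiv.sumCompl WA)

end Circles

end LinkDiagram

/-! ### Homology and Euler characteristic of one region -/

theorem LinearMap.finrank_range_add_finrank_ker_int {M N : Type*} [AddCommGroup M] [AddCommGroup N]
    [Module.Finite ℤ M] (f : M →ₗ[ℤ] N) :
    Module.finrank ℤ (LinearMap.range f) + Module.finrank ℤ (LinearMap.ker f) =
      Module.finrank ℤ M := by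
  rw [← Submodule.finrank_quotient_add_finrank (LinearMap.ker f), f.quotKerEquivRange.finrank_eq]

theorem finrank_finsupp_int (X : Type*) [Finite X] : Module.finrank ℤ (X →₀ ℤ) = Nat.card X := by
  have := Fintype.ofFinite X
  simp

namespace GraphSurface

variable {S : GraphSurface.{u}}

theorem rev_notMem_graph {x : S.Dart} (h : x ∉ S.graph) : S.rev x ∉ S.graph :=
  fun h' => h (by simpa [S.rev_rev] using S.rev_mem_graph _ h')

/-- The polygons in a region. -/
abbrev PolygonIn (R : S.Region) : Type u := {f : S.Polygon // (Quot.mk _ f : S.Region) = R}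

/-- The polygon of a side. -/
def polygonOf {R : S.Region} (x : Side R) : PolygonIn R :=
  ⟨⟨S.faceOf x.1, x.2.choose⟩, x.2.choose_spec⟩

theorem polygonOf_surjective (R : S.Region) : Function.Surjective (polygonOf (R := R)) := by
  rintro ⟨⟨f, hf⟩, hR⟩
  induction f using Quotient.ind with | _ x => exact ⟨⟨x, hf, hR⟩, rfl⟩

theorem polygonOf_eq_iff {R : S.Region} {x : Side R} {p : PolygonIn R} :
    polygonOf x = p ↔ S.faceOf x.1 = p.1.1 :=
  ⟨fun h => h ▸ rfl, fun h => Subtype.ext (Subtype.ext h)⟩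

theorem polygonOf_nextSide {R : S.Region} (x : Side R) : polygonOf (nextSide x) = polygonOf x :=
  polygonOf_eq_iff.2 (S.faceOf_facePerm x.1)

theorem nonempty_side (R : S.Region) : Nonempty (Side R) := by
  obtain ⟨⟨f, hf⟩⟩ := R
  obtain ⟨x, -⟩ := polygonOf_surjective (S := S) _ ⟨⟨f, hf⟩, rfl⟩
  exact ⟨x⟩

/-- The sides of a region that are glued to other sides. -/
abbrev GluedSide (R : S.Region) : Type u := {x : Side R // x.1 ∉ S.graph}

section Glued

variable (hS : ∀ x ∉ S.graph, S.faceOf x ∉ S.hole)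

/-- The side to which a side is glued. -/
def revSide {R : S.Region} (x : GluedSide R) : GluedSide R :=
  ⟨⟨S.rev x.1.1, hS _ (rev_notMem_graph x.2), by
    obtain ⟨_, hR⟩ := x.1.2
    exact (quot_mk_eq_of_rel ⟨x.1.1, x.2, rfl, rfl⟩ : _ = _).trans hR⟩, rev_notMem_graph x.2⟩

theorem revSide_involutive {R : S.Region} : Function.Involutive (revSide hS (R := R)) :=
  fun _ => Subtype.ext (Subtype.ext (S.rev_rev _))

theorem revSide_ne {R : S.Region} (x : GluedSide R) : revSide hS x ≠ x :=
  fun h => S.rev_ne _ (congrArg (fun y : GluedSide R => y.1.1) h)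

/-- The edges of a region, where two sides are glued. -/
abbrev GluedEdge (R : S.Region) : Type u := Quot fun x y : GluedSide R => y = revSide hS x

theorem two_mul_card_gluedEdge (R : S.Region) :
    2 * Nat.card (GluedEdge hS R) = Nat.card (GluedSide R) := by
  have := two_mul_numClasses_involutive (revSide_involutive hS (R := R))
  have h0 : IsEmpty {x : GluedSide R // revSide hS x = x} := ⟨fun x => revSide_ne hS _ x.2⟩
  rwa [Nat.card_of_isEmpty (α := {x : GluedSide R // revSide hS x = x}), add_zero] at this

theorem gluedEdge_mk_eq {R : S.Region} {x y : GluedSide R}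
    (h : (Quot.mk _ x : GluedEdge hS R) = Quot.mk _ y) : x = y ∨ x = revSide hS y := by
  replace h := Quot.eqvGen_exact h
  have hi := revSide_involutive hS (R := R)
  induction h with
  | rel a b h => right; rw [h, hi]
  | refl a => exact Or.inl rfl
  | symm a b _ ih =>
    rcases ih with h | h
    · exact Or.inl h.symm
    · right; rw [h, hi]
  | trans a b c _ _ ih1 ih2 =>
    rcases ih1 with h | h <;> rcases ih2 with h' | h' <;> subst h h' <;> simp [hi _]

/-- A region is connected. -/
theorem eq_of_connected {R : S.Region} {α : Type*} (a : Side R → α)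
    (h1 : ∀ x, a (nextSide x) = a x) (h2 : ∀ x : GluedSide R, a (revSide hS x).1 = a x.1)
    (x y : Side R) : a x = a y := by
  classical
  have hface : ∀ x y : Side R, S.faceOf x.1 = S.faceOf y.1 → a x = a y := by
    intro x y h
    have h : S.facePerm.SameCycle x.1 y.1 := Quotient.exact h
    obtain ⟨n, hn⟩ := h.exists_nat_pow_eq
    have key : ∀ n : ℕ, ∀ z : Side R, (S.facePerm ^ n) x.1 = z.1 → a x = a z := by
      intro n
      induction n with
      | zero => intro z hz; rw [Subtype.ext (a1 := x) (a2 := z) hz]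
      | succ n ih =>
        intro z hz
        have hw : ∃ w : Side R, w.1 = (S.facePerm ^ n) x.1 := by
          refine ⟨nextSide^[n] x, ?_⟩
          clear hz ih hn
          induction n with
          | zero => rfl
          | succ n ih =>
            rw [Function.iterate_succ_apply', pow_succ', Equiv.Perm.mul_apply, ← ih]
            rfl
        obtain ⟨w, hw⟩ := hw
        rw [ih w hw.symm, ← h1 w]
        congr 1
        apply Subtype.ext
        change S.facePerm w.1 = z.1
        rw [hw, ← hz, pow_succ', Equiv.Perm.mul_apply]
    exact key n y hn
  -- Extended by `none` to the polygons outside `R`, the function descends to the set of regions,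
  -- where it can be evaluated at `R`.
  let A : S.Polygon → Option α := fun f =>
    if h : ∃ x : Side R, S.faceOf x.1 = f.1 then some (a h.choose) else none
  have hA : ∀ x : Side R, ∀ f : S.Polygon, f.1 = S.faceOf x.1 → A f = some (a x) := by
    intro x f hf
    have h : ∃ y : Side R, S.faceOf y.1 = f.1 := ⟨x, hf.symm⟩
    simp only [A, dif_pos h]
    exact congrArg some (hface _ _ (h.choose_spec.trans hf))
  have key : ∀ f g : S.Polygon, (∃ x, x ∉ S.graph ∧ S.faceOf x = f.1 ∧ S.faceOf (S.rev x) = g.1) →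
      A f = A g := by
    rintro f g ⟨x, hx, hf, hg⟩
    have hfg : (Quot.mk _ f : S.Region) = Quot.mk _ g := Quot.sound ⟨x, hx, hf, hg⟩
    by_cases hR : (Quot.mk _ f : S.Region) = R
    · let x' : GluedSide R := ⟨⟨x, hf ▸ f.2, by
        rw [← hR]; exact congrArg _ (Subtype.ext hf)⟩, hx⟩
      rw [hA x'.1 f hf.symm, hA (revSide hS x').1 g hg.symm, h2]
    · have no : ∀ k : S.Polygon, (Quot.mk _ k : S.Region) ≠ R → A k = none := by
        intro k hk
        refine dif_neg ?_
        rintro ⟨y, hy⟩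
        obtain ⟨h, e⟩ := y.2
        exact hk (by rw [← e]; exact congrArg _ (Subtype.ext hy.symm))
      rw [no f hR, no g (hfg ▸ hR)]
  have e := congrArg (Quot.lift A key) ((polygonOf x).2.trans (polygonOf y).2.symm)
  change A (polygonOf x).1 = A (polygonOf y).1 at e
  rw [hA x _ rfl, hA y _ rfl] at e
  exact Option.some.inj e

-- This is H₀ = ℤ: connectedness identifies all corners modulo boundaries, so the image of the
-- boundary map is the kernel of the augmentation.
include hS in
theorem finrank_range_boundaryMap (R : S.Region) :
    Module.finrank ℤ (LinearMap.range (boundaryMap R)) + 1 = Nat.card (Corner R) := by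
  let aug : (Corner R →₀ ℤ) →ₗ[ℤ] ℤ := Finsupp.linearCombination ℤ fun _ => 1
  obtain ⟨x₀⟩ := nonempty_side R
  have hmk : ∀ x : GluedSide R, (Quot.mk _ (nextSide (revSide hS x).1) : Corner R) =
      Quot.mk _ x.1 := fun x => by
    refine quot_mk_eq_of_rel ⟨x.2, ?_⟩
    exact S.facePerm_rev x.1.1
  let Q := (LinearMap.range (boundaryMap R)).mkQ
  let q : Side R → (Corner R →₀ ℤ) ⧸ LinearMap.range (boundaryMap R) := fun x =>
    Q (Finsupp.single (Quot.mk _ x) 1)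
  have q1 : ∀ x, q (nextSide x) = q x := by
    intro x
    rw [← sub_eq_zero, ← map_sub, Submodule.mkQ_apply, Submodule.Quotient.mk_eq_zero]
    refine ⟨Finsupp.single x 1, ?_⟩
    rw [boundaryMap, Finsupp.linearCombination_single, one_smul]
  have q2 : ∀ x : GluedSide R, q (revSide hS x).1 = q x.1 := by
    intro x
    rw [← q1]
    simp only [q, hmk]
  have hQ : ∀ c, Q c = aug c • q x₀ := by
    intro c
    have : Q = aug.smulRight (q x₀) := by
      ext z
      induction z using Quot.ind with | mk x => ?_
      simp only [LinearMap.comp_apply, Finsupp.lsingle_apply, LinearMap.smulRight_apply, aug,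
        Finsupp.linearCombination_single, one_smul]
      exact eq_of_connected hS q q1 q2 x x₀
    rw [this]; rfl
  have hr : LinearMap.range (boundaryMap R) = LinearMap.ker aug := by
    apply le_antisymm
    · rw [LinearMap.range_le_ker_iff]
      ext x
      simp [boundaryMap, aug]
    · intro c hc
      have := hQ c
      rw [LinearMap.mem_ker.1 hc, zero_smul] at this
      rwa [← Submodule.Quotient.mk_eq_zero]
  have hs : LinearMap.range aug = ⊤ := by
    rw [LinearMap.range_eq_top]
    intro n
    exact ⟨Finsupp.single (Quot.mk _ x₀) n, by simp [aug]⟩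
  have := LinearMap.finrank_range_add_finrank_ker_int aug
  rw [hs, finrank_top, finrank_finsupp_int, Module.finrank_self] at this
  rw [hr, ← this, add_comm]

/-- The generators of the submodule `boundaries R`. -/
def boundaryGen (R : S.Region) : PolygonIn R ⊕ GluedEdge hS R → (Side R →₀ ℤ) :=
  Sum.elim (fun p => ∑ᶠ x ∈ {x : Side R | S.faceOf x.1 = p.1.1}, Finsupp.single x 1)
    (Quot.lift (fun x => Finsupp.single x.1 1 + Finsupp.single (revSide hS x).1 1) (by
      rintro x y rfl
      rw [revSide_involutive hS, add_comm]))

theorem boundaries_eq_span (R : S.Region) :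
    boundaries R = Submodule.span ℤ (Set.range (boundaryGen hS R)) := by
  apply le_antisymm
  · refine Submodule.span_le.2 ?_
    rintro c (⟨f, rfl⟩ | ⟨x, y, hx, hy, rfl⟩)
    · by_cases h : ∃ x : Side R, S.faceOf x.1 = f
      · obtain ⟨x, rfl⟩ := h
        exact Submodule.subset_span ⟨Sum.inl (polygonOf x), rfl⟩
      · have : {x : Side R | S.faceOf x.1 = f} = ∅ :=
          Set.eq_empty_of_forall_notMem fun x hx => h ⟨x, hx⟩
        rw [this, finsum_mem_empty]
        exact Submodule.zero_mem _
    · obtain rfl : y = (revSide hS ⟨x, hx⟩).1 := Subtype.ext hy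
      exact Submodule.subset_span ⟨Sum.inr (Quot.mk _ ⟨x, hx⟩), rfl⟩
  · refine Submodule.span_mono ?_
    rintro _ ⟨p | q, rfl⟩
    · exact Or.inl ⟨p.1.1, rfl⟩
    · induction q using Quot.ind with | mk x => ?_
      exact Or.inr ⟨x.1, (revSide hS x).1, x.2, rfl, rfl⟩

theorem sum_face_eq (R : S.Region) [Fintype (Side R)] [DecidableEq S.Face] (f : S.Face) :
    ∑ᶠ x ∈ {x : Side R | S.faceOf x.1 = f}, Finsupp.single x (1 : ℤ) =
      ∑ x : Side R with S.faceOf x.1 = f, Finsupp.single x 1 := by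
  rw [finsum_mem_eq_finite_toFinset_sum _ (Set.toFinite _)]
  congr 1
  ext x; simp

theorem boundaries_le_ker (R : S.Region) : boundaries R ≤ LinearMap.ker (boundaryMap R) := by
  classical
  have := Fintype.ofFinite (Side R)
  refine Submodule.span_le.2 ?_
  have hsingle : ∀ x : Side R, boundaryMap R (Finsupp.single x 1) =
      Finsupp.single (Quot.mk _ (nextSide x)) 1 - Finsupp.single (Quot.mk _ x) 1 := fun x => by
    rw [boundaryMap, Finsupp.linearCombination_single, one_smul]
  rintro c (⟨f, rfl⟩ | ⟨x, y, hx, hy, rfl⟩)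
  · rw [SetLike.mem_coe, LinearMap.mem_ker, sum_face_eq, map_sum, Finset.sum_congr rfl
      fun x _ => hsingle x, Finset.sum_sub_distrib, sub_eq_zero]
    have hinj : Function.Injective (nextSide (R := R)) := fun x y h =>
      Subtype.ext (S.facePerm.injective (congrArg Subtype.val h))
    refine Finset.sum_equiv (Equiv.ofBijective _ (Finite.injective_iff_bijective.1 hinj))
      (fun x => ?_) fun x _ => rfl
    simp only [Finset.mem_filter, Finset.mem_univ, true_and]
    rw [show S.faceOf ((Equiv.ofBijective _ (Finite.injective_iff_bijective.1 hinj)) x).1 =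
      S.faceOf x.1 from S.faceOf_facePerm x.1]
  · rw [SetLike.mem_coe, LinearMap.mem_ker, map_add, hsingle, hsingle]
    have e1 : (Quot.mk _ (nextSide y) : Corner R) = Quot.mk _ x := by
      refine quot_mk_eq_of_rel ⟨hx, ?_⟩
      change S.facePerm y.1 = _
      rw [hy]; exact S.facePerm_rev x.1
    have e2 : (Quot.mk _ (nextSide x) : Corner R) = Quot.mk _ y := by
      refine quot_mk_eq_of_rel ⟨hy ▸ rev_notMem_graph hx, ?_⟩
      change S.facePerm x.1 = _
      rw [hy]; rfl
    rw [e1, e2]; abel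

/-- This is H₂ = 0 for non-empty boundary. In a relation, a glued side forces the coefficients of
its polygon and its edge to cancel, so all polygons of the region have the same coefficient; a side
on the graph meets no edge generator and makes it zero. -/
theorem boundaryGen_linearIndependent (R : S.Region) (hR : ∃ x : Side R, x.1 ∈ S.graph) :
    LinearIndependent ℤ (boundaryGen hS R) := by
  classical
  have := Fintype.ofFinite (Side R)
  have := Fintype.ofFinite (PolygonIn R)
  have := Fintype.ofFinite (GluedEdge hS R)
  rw [Fintype.linearIndependent_iff]
  intro g hg
  have gp : ∀ (p : PolygonIn R) (x : Side R),
      boundaryGen hS R (Sum.inl p) x = if p = polygonOf x then 1 else 0 := by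
    intro p x
    change (∑ᶠ x ∈ {x : Side R | S.faceOf x.1 = p.1.1}, Finsupp.single x (1 : ℤ)) x = _
    rw [sum_face_eq, Finsupp.finsetSum_apply]
    simp only [Finsupp.single_apply, Finset.sum_ite_eq', Finset.mem_filter, Finset.mem_univ,
      true_and, ← polygonOf_eq_iff]
    by_cases h : polygonOf x = p
    · rw [if_pos h, if_pos h.symm]
    · rw [if_neg h, if_neg (Ne.symm h)]
  have ge : ∀ (e : GluedEdge hS R) (x : GluedSide R),
      boundaryGen hS R (Sum.inr e) x.1 = if e = Quot.mk _ x then 1 else 0 := by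
    intro e x
    induction e using Quot.ind with | mk y => ?_
    change (Finsupp.single y.1 1 + Finsupp.single (revSide hS y).1 1 : Side R →₀ ℤ) x.1 = _
    rw [Finsupp.add_apply, Finsupp.single_apply, Finsupp.single_apply]
    by_cases h : (Quot.mk _ y : GluedEdge hS R) = Quot.mk _ x
    · rw [if_pos h]
      rcases gluedEdge_mk_eq hS h with rfl | rfl
      · rw [if_pos rfl, if_neg fun h => revSide_ne hS y (Subtype.ext h), add_zero]
      · rw [revSide_involutive hS, if_pos rfl,
          if_neg fun h => revSide_ne hS x (Subtype.ext h), zero_add]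
    · rw [if_neg h, if_neg, if_neg, add_zero]
      · intro h'
        apply h
        rw [← Subtype.ext (a2 := x) h']
        exact Quot.sound rfl
      · intro h'
        exact h (by rw [Subtype.ext (a1 := y) (a2 := x) h'])
  have ge' : ∀ (e : GluedEdge hS R) (x : Side R), x.1 ∈ S.graph →
      boundaryGen hS R (Sum.inr e) x = 0 := by
    intro e x hx
    induction e using Quot.ind with | mk y => ?_
    change (Finsupp.single y.1 1 + Finsupp.single (revSide hS y).1 1 : Side R →₀ ℤ) x = _
    rw [Finsupp.add_apply, Finsupp.single_apply, Finsupp.single_apply, if_neg, if_neg, add_zero]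
    · rintro rfl; exact (revSide hS y).2 hx
    · rintro rfl; exact y.2 hx
  have hx : ∀ x : Side R, g (Sum.inl (polygonOf x)) +
      ∑ e, g (Sum.inr e) * boundaryGen hS R (Sum.inr e) x = 0 := by
    intro x
    have h := DFunLike.congr_fun hg x
    rw [Finsupp.finsetSum_apply, Fintype.sum_sum_type] at h
    simpa [gp] using h
  have hx1 : ∀ x : GluedSide R, g (Sum.inl (polygonOf x.1)) + g (Sum.inr (Quot.mk _ x)) = 0 := by
    intro x
    have h := hx x.1
    simpa [ge] using h
  obtain ⟨x₀, hx₀⟩ := hR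
  have h0 : g (Sum.inl (polygonOf x₀)) = 0 := by
    have h := hx x₀
    simpa [ge' _ x₀ hx₀] using h
  have hp : ∀ x : Side R, g (Sum.inl (polygonOf x)) = 0 := by
    intro x
    rw [← h0]
    refine eq_of_connected hS (fun x => g (Sum.inl (polygonOf x))) (fun x => ?_) (fun x => ?_) x x₀
    · simp only [polygonOf_nextSide]
    · have h1 := hx1 x
      have h2 := hx1 (revSide hS x)
      have h3 : (Quot.mk _ (revSide hS x) : GluedEdge hS R) = Quot.mk _ x :=
        quot_mk_eq_of_rel rfl
      rw [h3] at h2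
      exact add_right_cancel (h2.trans h1.symm)
  rintro (p | e)
  · obtain ⟨x, rfl⟩ := polygonOf_surjective R p
    exact hp x
  · induction e using Quot.ind with | mk x => ?_
    have := hx1 x
    rwa [hp, zero_add] at this

/-- The Euler characteristic of a region with non-empty boundary is one minus the rank of its first
homology group. -/
theorem h1Rank_add (R : S.Region) (hR : ∃ x : Side R, x.1 ∈ S.graph) :
    h1Rank R + Nat.card (Corner R) + Nat.card (PolygonIn R) + Nat.card (GluedEdge hS R) =
      Nat.card (Side R) + 1 := by
  have := Fintype.ofFinite (PolygonIn R)
  have := Fintype.ofFinite (GluedEdge hS R)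
  -- The rank of H₁ is the number of sides minus the rank of the boundary map minus the rank of
  -- `boundaries R`. The relations for glued edges reduce sides to edges, so this is the usual Euler
  -- characteristic.
  have h1 := Submodule.finrank_quotient_add_finrank
    ((boundaries R).submoduleOf (LinearMap.ker (boundaryMap R)))
  rw [(Submodule.submoduleOfEquivOfLe (boundaries_le_ker R)).finrank_eq] at h1
  have h2 := LinearMap.finrank_range_add_finrank_ker_int (boundaryMap R)
  rw [finrank_finsupp_int] at h2
  have h3 := finrank_range_boundaryMap hS R
  have h4 : Module.finrank ℤ (boundaries R) =
      Nat.card (PolygonIn R) + Nat.card (GluedEdge hS R) := by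
    rw [boundaries_eq_span hS, finrank_span_eq_card (boundaryGen_linearIndependent hS R hR),
      Fintype.card_sum, Nat.card_eq_fintype_card, Nat.card_eq_fintype_card]
  change h1Rank R + _ = _ at h1
  omega

end Glued

end GraphSurface

/-! ### Summation over all regions -/

theorem card_eq_sum_fiber {X Y : Type*} [Finite X] [Fintype Y] (f : X → Y) :
    Nat.card X = ∑ y, Nat.card {x // f x = y} := by
  rw [← Nat.card_sigma]
  exact (Nat.card_congr (Equiv.sigmaFiberEquiv f)).symm

namespace GraphSurface

variable {S : GraphSurface.{u}}

variable (S) in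
/-- The sides of all polygons of the surface. -/
abbrev AllSide : Type u := {x : S.Dart // S.faceOf x ∉ S.hole}

/-- The region of a side. -/
def regionOf (x : S.AllSide) : S.Region := Quot.mk _ ⟨S.faceOf x.1, x.2⟩

theorem regionOf_eq_of_faceOf {x y : S.AllSide} (h : S.faceOf x.1 = S.faceOf y.1) :
    regionOf x = regionOf y := congrArg (Quot.mk _) (Subtype.ext h)

theorem regionOf_eq_of_rev {x y : S.AllSide} (hx : x.1 ∉ S.graph) (h : y.1 = S.rev x.1) :
    regionOf y = regionOf x :=
  quot_mk_eq_of_rel ⟨x.1, hx, rfl, congrArg S.faceOf h.symm⟩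

variable (S) in
/-- The corners of all regions. -/
abbrev AllCorner : Type u :=
  Quot fun x y : S.AllSide => x.1 ∉ S.graph ∧ y.1 = S.rot⁻¹ x.1

theorem card_allSide [Fintype S.Region] :
    Nat.card S.AllSide = ∑ R : S.Region, Nat.card (Side R) := by
  rw [card_eq_sum_fiber (regionOf (S := S))]
  refine Finset.sum_congr rfl fun R _ => Nat.card_congr
    { toFun := fun x => ⟨x.1.1, x.1.2, x.2⟩
      invFun := fun x => ⟨⟨x.1, x.2.choose⟩, x.2.choose_spec⟩
      left_inv := fun _ => rfl
      right_inv := fun _ => rfl }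

theorem card_polygon [Fintype S.Region] :
    Nat.card S.Polygon = ∑ R : S.Region, Nat.card (PolygonIn R) :=
  card_eq_sum_fiber _

section

variable (hS : ∀ x ∉ S.graph, S.faceOf x ∉ S.hole)

include hS

theorem card_notMem_graph [Fintype S.Region] :
    Nat.card {x // x ∉ S.graph} = ∑ R : S.Region, Nat.card (GluedSide R) := by
  rw [card_eq_sum_fiber fun x : {x // x ∉ S.graph} => regionOf ⟨x.1, hS x.1 x.2⟩]
  refine Finset.sum_congr rfl fun R _ => Nat.card_congr
    { toFun := fun x => ⟨⟨x.1.1, hS _ x.1.2, x.2⟩, x.1.2⟩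
      invFun := fun x => ⟨⟨x.1.1, x.2⟩, x.1.2.choose_spec⟩
      left_inv := fun _ => rfl
      right_inv := fun _ => rfl }

theorem card_allCorner [Fintype S.Region] :
    Nat.card S.AllCorner = ∑ R : S.Region, Nat.card (Corner R) := by
  rw [← Nat.card_sigma]
  let s : S.AllSide → Σ R : S.Region, Corner R := fun x => ⟨regionOf x, Quot.mk _ ⟨x.1, x.2, rfl⟩⟩
  have hs : ∀ (R : S.Region) (x : S.AllSide) (h : regionOf x = R),
      s x = ⟨R, Quot.mk _ ⟨x.1, x.2, h⟩⟩ := by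
    rintro R x rfl; rfl
  refine Nat.card_congr
    { toFun := Quot.lift s ?_
      invFun := fun c => Quot.lift (fun x : Side c.1 => (Quot.mk _ ⟨x.1, x.2.choose⟩ : S.AllCorner))
        (fun x y h => Quot.sound h) c.2
      left_inv := ?_
      right_inv := ?_ }
  · rintro x y ⟨hx, hy⟩
    -- The dart `rot⁻¹ x` is the side after `rev x` on its polygon, and that polygon is glued to the
    -- one of `x`.
    have hr : regionOf y = regionOf x := by
      have h := rev_notMem_graph hx
      refine Eq.trans (regionOf_eq_of_faceOf (y := ⟨S.rev x.1, hS _ h⟩) ?_)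
        (regionOf_eq_of_rev hx rfl)
      rw [hy, ← S.facePerm_rev]
      exact S.faceOf_facePerm _
    rw [hs _ y hr]
    exact congrArg (Sigma.mk (regionOf x)) (Quot.sound ⟨hx, hy⟩)
  · rintro ⟨x⟩; rfl
  · rintro ⟨R, c⟩
    induction c using Quot.ind with | mk x => ?_
    exact hs R ⟨x.1, x.2.choose⟩ x.2.choose_spec

/-- The sum of the Euler characteristics of the regions. -/
theorem sum_h1Rank (hR : ∀ R : S.Region, ∃ x : Side R, x.1 ∈ S.graph) :
    2 * ∑ᶠ R : S.Region, h1Rank R + 2 * Nat.card S.AllCorner + 2 * Nat.card S.Polygon +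
      Nat.card {x // x ∉ S.graph} = 2 * Nat.card S.AllSide + 2 * Nat.card S.Region := by
  have := Fintype.ofFinite S.Region
  have h := Finset.sum_congr (rfl : (Finset.univ : Finset S.Region) = _)
    fun R _ => h1Rank_add hS R (hR R)
  have h2 := Finset.sum_congr (rfl : (Finset.univ : Finset S.Region) = _)
    fun R _ => two_mul_card_gluedEdge hS R
  simp only [Finset.sum_add_distrib, ← Finset.mul_sum] at h h2
  rw [← card_allSide, ← card_polygon, ← card_allCorner hS, Finset.sum_const, Finset.card_univ,
    smul_eq_mul, mul_one, ← Nat.card_eq_fintype_card] at h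
  rw [← card_notMem_graph hS] at h2
  rw [finsum_eq_sum_of_fintype]
  omega

end

end GraphSurface

/-! ### The faces after the surgery -/

theorem CombMap.eq_of_faceOf_eq {M : CombMap.{u}} {α : Type*} (a : M.Dart → α)
    (h : ∀ x, a (M.facePerm x) = a x) {x y : M.Dart} (hxy : M.faceOf x = M.faceOf y) :
    a x = a y := by
  have hs : M.facePerm.SameCycle x y := Quotient.exact hxy
  exact congrArg (Quot.lift a fun x y e => by rw [e, h]) ((mk_eq_iff_sameCycle _ x y).2 hs)

namespace LinkDiagram

open Equiv SurgeryDart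

variable {D : LinkDiagram.{u}} {K : Set D.Vertex}

section FacePerm

variable (K)

theorem surface_facePerm_old_of_mem {x : D.Dart} (h : D.vertexOf (D.rev x) ∈ K) :
    (D.surface K).facePerm (old x) = arcPrev ⟨D.rev x, h⟩ := dif_pos h

theorem surface_facePerm_old_of_notMem {x : D.Dart} (h : D.vertexOf (D.rev x) ∉ K) :
    (D.surface K).facePerm (old x) = old (D.facePerm x) := dif_neg h

/-- The hypotheses are invariance under each kind of step along a face: around a hole (`h1`), around
a band (`h2`, `h3`), and around an old face with the corners at `K` cut off by arcs (`h4`, `h5`,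
`h6`). -/
theorem eq_of_surface_faceOf_eq {α : Type*} (a : D.SurgeryDart K → α)
    (h1 : ∀ x, a (sidePrev ((D.rotAt K)⁻¹ x)) = a (sidePrev x))
    (h2 : ∀ x, a (arcNext (D.rotAt K x)) = a (sideNext x))
    (h3 : ∀ x, a (sideNext (D.rotAt K x)) = a (arcNext x))
    (h4 : ∀ x, a (old (D.rot⁻¹ x.1)) = a (arcPrev x))
    (h5 : ∀ x (h : D.vertexOf (D.rev x) ∈ K), a (arcPrev ⟨D.rev x, h⟩) = a (old x))
    (h6 : ∀ x, D.vertexOf (D.rev x) ∉ K → a (old (D.facePerm x)) = a (old x))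
    {x y : D.SurgeryDart K} (hxy : (D.surface K).faceOf x = (D.surface K).faceOf y) :
    a x = a y := by
  refine CombMap.eq_of_faceOf_eq (M := (D.surface K).toCombMap) a ?_ hxy
  rintro (x | x | x | x | x)
  · by_cases h : D.vertexOf (D.rev x) ∈ K
    · rw [surface_facePerm_old_of_mem K h, h5]
    · rw [surface_facePerm_old_of_notMem K h, h6 x h]
  · exact h3 x
  · exact h4 x
  · exact h2 x
  · exact h1 x

theorem surface_faceOf_mem_hole_iff (s : D.SurgeryDart K) :
    (D.surface K).faceOf s ∈ (D.surface K).hole ↔ ∃ x, s = sidePrev x := by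
  constructor
  · rintro ⟨x, hx⟩
    refine (eq_of_surface_faceOf_eq K (fun s => ∃ x, s = sidePrev x)
      ?_ ?_ ?_ ?_ ?_ ?_ hx).mpr ⟨x, rfl⟩ <;> intros <;> simp
  · rintro ⟨x, rfl⟩
    exact ⟨x, rfl⟩

theorem surface_graph_iff (s : D.SurgeryDart K) : s ∈ (D.surface K).graph ↔
    (∃ x ∈ D.proj, s = old x) ∨ (∃ x, s = sideNext x) ∨ ∃ x, s = sidePrev x := Iff.rfl

theorem old_notMem_graph {x : D.Dart} (hx : x ∉ D.proj) : old x ∉ (D.surface K).graph := by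
  intro h
  rcases (surface_graph_iff K _).1 h with ⟨y, hy, e⟩ | ⟨y, e⟩ | ⟨y, e⟩ <;> cases e
  exact hx hy

theorem arcNext_notMem_graph (x : D.DartAt K) : arcNext x ∉ (D.surface K).graph := by
  intro h
  rcases (surface_graph_iff K _).1 h with ⟨y, hy, e⟩ | ⟨y, e⟩ | ⟨y, e⟩ <;> cases e

theorem arcPrev_notMem_graph (x : D.DartAt K) : arcPrev x ∉ (D.surface K).graph := by
  intro h
  rcases (surface_graph_iff K _).1 h with ⟨y, hy, e⟩ | ⟨y, e⟩ | ⟨y, e⟩ <;> cases e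

theorem surface_faceOf_notMem_hole {s : D.SurgeryDart K} (hs : s ∉ (D.surface K).graph) :
    (D.surface K).faceOf s ∉ (D.surface K).hole := fun h =>
  hs (Or.inr (Or.inr ((surface_faceOf_mem_hole_iff K s).1 h)))

theorem faceOf_old_notMem_hole (x : D.Dart) :
    (D.surface K).faceOf (old x) ∉ (D.surface K).hole := by
  rw [surface_faceOf_mem_hole_iff]; simp

theorem faceOf_arcNext_notMem_hole (x : D.DartAt K) :
    (D.surface K).faceOf (arcNext x) ∉ (D.surface K).hole := by
  rw [surface_faceOf_mem_hole_iff]; simp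

theorem faceOf_arcPrev_notMem_hole (x : D.DartAt K) :
    (D.surface K).faceOf (arcPrev x) ∉ (D.surface K).hole := by
  rw [surface_faceOf_mem_hole_iff]; simp

theorem faceOf_sideNext_notMem_hole (x : D.DartAt K) :
    (D.surface K).faceOf (sideNext x) ∉ (D.surface K).hole := by
  rw [surface_faceOf_mem_hole_iff]; simp

theorem faceOf_arcPrev (x : D.DartAt K) :
    (D.surface K).faceOf (arcPrev x) = (D.surface K).faceOf (old (D.rot⁻¹ x.1)) :=
  ((D.surface K).faceOf_facePerm (arcPrev x)).symm

theorem faceOf_sideNext (x : D.DartAt K) :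
    (D.surface K).faceOf (sideNext x) = (D.surface K).faceOf (arcNext (D.rotAt K x)) :=
  ((D.surface K).faceOf_facePerm (sideNext x)).symm

theorem faceOf_arcNext_rot_rot (x : D.DartAt K) :
    (D.surface K).faceOf (arcNext (D.rotAt K (D.rotAt K x))) =
      (D.surface K).faceOf (arcNext x) := by
  rw [← faceOf_sideNext]
  exact (D.surface K).faceOf_facePerm (arcNext x)

theorem faceOf_old_facePerm (x : D.Dart) :
    (D.surface K).faceOf (old (D.facePerm x)) = (D.surface K).faceOf (old x) := by
  rw [← (D.surface K).faceOf_facePerm (old x)]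
  by_cases h : D.vertexOf (D.rev x) ∈ K
  · rw [surface_facePerm_old_of_mem K h, faceOf_arcPrev]; rfl
  · rw [surface_facePerm_old_of_notMem K h]

end FacePerm

/-! ### Cell counts and regions of the surgered surface -/

section Counting

theorem card_allSide_surface :
    Nat.card (D.surface K).AllSide = Nat.card D.Dart + 3 * Nat.card (D.DartAt K) := by
  let f : D.Dart ⊕ D.DartAt K ⊕ D.DartAt K ⊕ D.DartAt K → (D.surface K).AllSide :=
    Sum.elim (fun x => ⟨old x, faceOf_old_notMem_hole K x⟩)
      (Sum.elim (fun x => ⟨arcNext x, faceOf_arcNext_notMem_hole K x⟩)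
        (Sum.elim (fun x => ⟨arcPrev x, faceOf_arcPrev_notMem_hole K x⟩)
          (fun x => ⟨sideNext x, faceOf_sideNext_notMem_hole K x⟩)))
  have hf : Function.Bijective f := by
    constructor
    · rintro (x | x | x | x) (y | y | y | y) h <;> have h := congrArg Subtype.val h <;>
        simp only [f, Sum.elim_inl, Sum.elim_inr] at h <;> cases h <;> rfl
    · rintro ⟨x | x | x | x | x, hx⟩
      · exact ⟨Sum.inl x, rfl⟩
      · exact ⟨Sum.inr (Sum.inl x), rfl⟩
      · exact ⟨Sum.inr (Sum.inr (Sum.inl x)), rfl⟩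
      · exact ⟨Sum.inr (Sum.inr (Sum.inr x)), rfl⟩
      · exact (hx ((surface_faceOf_mem_hole_iff K _).2 ⟨x, rfl⟩)).elim
  rw [← Nat.card_congr (Equiv.ofBijective f hf), Nat.card_sum, Nat.card_sum, Nat.card_sum]
  ring

theorem card_notMem_graph_surface :
    Nat.card {s // s ∉ (D.surface K).graph} + Nat.card D.proj =
      Nat.card D.Dart + 2 * Nat.card (D.DartAt K) := by
  let f : {x // x ∉ D.proj} ⊕ D.DartAt K ⊕ D.DartAt K → {s // s ∉ (D.surface K).graph} :=
    Sum.elim (fun x => ⟨old x.1, old_notMem_graph K x.2⟩)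
      (Sum.elim (fun x => ⟨arcNext x, arcNext_notMem_graph K x⟩)
        (fun x => ⟨arcPrev x, arcPrev_notMem_graph K x⟩))
  have hf : Function.Bijective f := by
    constructor
    · rintro (⟨x, hx⟩ | x | x) (⟨y, hy⟩ | y | y) h <;> have h := congrArg Subtype.val h <;>
        simp only [f, Sum.elim_inl, Sum.elim_inr] at h <;> cases h <;> rfl
    · rintro ⟨x | x | x | x | x, hx⟩
      · exact ⟨Sum.inl ⟨x, fun h => hx (Or.inl ⟨x, h, rfl⟩)⟩, rfl⟩
      · exact ⟨Sum.inr (Sum.inl x), rfl⟩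
      · exact ⟨Sum.inr (Sum.inr x), rfl⟩
      · exact (hx (Or.inr (Or.inl ⟨x, rfl⟩))).elim
      · exact (hx (Or.inr (Or.inr ⟨x, rfl⟩))).elim
  have e : Nat.card D.Dart = Nat.card D.proj + Nat.card {x // x ∉ D.proj} := by
    classical
    rw [← Nat.card_sum]
    exact (Nat.card_congr (Equiv.sumCompl fun x => x ∈ D.proj)).symm
  rw [← Nat.card_congr (Equiv.ofBijective f hf), Nat.card_sum, Nat.card_sum, e]
  ring

theorem surface_rot_inv_old {x : D.Dart} (h : D.vertexOf x ∉ K) :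
    (D.surface K).rot⁻¹ (old x) = old (D.rot⁻¹ x) := dif_neg h

theorem card_allCorner_surface (hK : K ⊆ D.crossings) :
    Nat.card (D.surface K).AllCorner =
      Nat.card D.proj + numFree D.proj D.rot⁻¹ + Nat.card (D.DartAt K) := by
  let Q := Quot (SlideRel D.proj D.rot⁻¹)
  -- Each point `a x` has two corners in the cut surface, one on either side of `old x` and each
  -- including a band. The first continues a corner of `D`, the second is new; `sidePrev x` belongs
  -- to the hole and its value is irrelevant.
  let c : D.SurgeryDart K → Q ⊕ D.DartAt K := fun s => match s with
    | old x => Sum.inl (Quot.mk _ x)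
    | arcNext x => Sum.inl (Quot.mk _ x.1)
    | arcPrev x => Sum.inr x
    | sideNext x => Sum.inr x
    | sidePrev x => Sum.inr x
  have hx : ∀ x, x ∉ D.proj → D.vertexOf x ∉ K := fun x h h' => h (atCrossing_of_mem hK h').1
  let f : (D.surface K).AllCorner → Q ⊕ D.DartAt K := Quot.lift (fun s => c s.1) (by
    rintro ⟨s, hs'⟩ ⟨t, ht'⟩ ⟨hs, ht⟩
    dsimp only at hs ht ⊢
    subst ht
    rcases s with x | x | x | x | x
    · have hxP : x ∉ D.proj := fun h => hs (Or.inl ⟨x, h, rfl⟩)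
      rw [surface_rot_inv_old (hx x hxP)]
      exact congrArg Sum.inl (Quot.sound ⟨hxP, rfl⟩)
    · rfl
    · rfl
    · exact (hs (Or.inr (Or.inl ⟨x, rfl⟩))).elim
    · exact (hs (Or.inr (Or.inr ⟨x, rfl⟩))).elim)
  let g : Q ⊕ D.DartAt K → (D.surface K).AllCorner := Sum.elim
    (Quot.lift (fun x => Quot.mk _ ⟨old x, faceOf_old_notMem_hole K x⟩) (by
      rintro x y ⟨h, rfl⟩
      exact Quot.sound ⟨old_notMem_graph K h, (surface_rot_inv_old (hx x h)).symm⟩))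
    (fun x => Quot.mk _ ⟨sideNext x, faceOf_sideNext_notMem_hole K x⟩)
  have e : (D.surface K).AllCorner ≃ Q ⊕ D.DartAt K :=
    { toFun := f
      invFun := g
      left_inv := by
        rintro ⟨x | x | x | x | x, hs⟩
        · rfl
        · exact quot_mk_eq_of_rel ⟨arcNext_notMem_graph K x, rfl⟩
        · exact quot_mk_eq_of_rel ⟨arcPrev_notMem_graph K x, rfl⟩
        · rfl
        · exact (hs ((surface_faceOf_mem_hole_iff K _).2 ⟨x, rfl⟩)).elim
      right_inv := by
        rintro (q | x)
        · induction q using Quot.ind with | mk x => rfl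
        · rfl }
  have h := numClasses_slideRel D.proj D.rot⁻¹
  rw [numClasses] at h
  rw [Nat.card_congr e, Nat.card_sum, h]

theorem rotAt_four (hK : K ⊆ D.crossings) (x : D.DartAt K) :
    D.rotAt K (D.rotAt K (D.rotAt K (D.rotAt K x))) = x :=
  Subtype.ext (atCrossing_of_mem hK x.2).rot_four

theorem card_polygon_surface (hK : K ⊆ D.crossings) :
    2 * Nat.card (D.surface K).Polygon =
      2 * numCycles D.facePerm + Nat.card (D.DartAt K) := by
  let b : D.DartAt K → D.DartAt K := fun x => D.rotAt K (D.rotAt K x)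
  -- A band is attached along the arcs starting at `a x` and at `a (rot (rot x))`, so bands are
  -- orbits of the half turn.
  let Band := Quot fun x y => y = b x
  have hb : ∀ x : D.DartAt K, (Quot.mk _ (D.rotAt K (D.rotAt K x)) : Band) = Quot.mk _ x :=
    fun x => quot_mk_eq_of_rel rfl
  let c : D.SurgeryDart K → Option (D.Face ⊕ Band) := fun s => match s with
    | old x => some (Sum.inl (D.faceOf x))
    | arcPrev x => some (Sum.inl (D.faceOf (D.rot⁻¹ x.1)))
    | arcNext x => some (Sum.inr (Quot.mk _ x))
    | sideNext x => some (Sum.inr (Quot.mk _ (D.rotAt K x)))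
    | sidePrev x => none
  have hc : ∀ s t : D.SurgeryDart K, (D.surface K).faceOf s = (D.surface K).faceOf t →
      c s = c t := by
    intro s t
    refine eq_of_surface_faceOf_eq K c (fun _ => rfl) (fun _ => rfl) (fun x => ?_) (fun _ => rfl)
      (fun x h => ?_) (fun x _ => ?_)
    · exact congrArg (fun z => some (Sum.inr z)) (hb x)
    · exact congrArg (fun z => some (Sum.inl z)) (D.faceOf_facePerm x)
    · exact congrArg (fun z => some (Sum.inl z)) (D.faceOf_facePerm x)
  let f : D.Face ⊕ Band → (D.surface K).Polygon := Sum.elim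
    (Quotient.lift (fun x => ⟨(D.surface K).faceOf (old x), faceOf_old_notMem_hole K x⟩)
      fun x y h => Subtype.ext (CombMap.eq_of_faceOf_eq
        (fun x => (D.surface K).faceOf (old x)) (faceOf_old_facePerm K) (Quotient.sound h)))
    (Quot.lift (fun x => ⟨(D.surface K).faceOf (arcNext x), faceOf_arcNext_notMem_hole K x⟩)
      (by rintro x y rfl; exact Subtype.ext (faceOf_arcNext_rot_rot K x).symm))
  have hf : Function.Bijective f := by
    constructor
    · have key : ∀ z : D.Face ⊕ Band, ∀ s, (f z).1 = (D.surface K).faceOf s → c s = some z := by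
        rintro (z | z) s hs
        · induction z using Quotient.ind with | _ x => exact (hc _ s hs).symm
        · induction z using Quot.ind with | mk x => exact (hc _ s hs).symm
      intro z w h
      obtain ⟨s, hs⟩ := Quotient.exists_rep (f z).1
      exact Option.some.inj ((key z s hs.symm).symm.trans (key w s (h ▸ hs.symm)))
    · rintro ⟨p, hp⟩
      induction p using Quotient.ind with | _ s => ?_
      rcases s with x | x | x | x | x
      · exact ⟨Sum.inl (D.faceOf x), rfl⟩
      · exact ⟨Sum.inr (Quot.mk _ x), rfl⟩
      · exact ⟨Sum.inl (D.faceOf (D.rot⁻¹ x.1)), Subtype.ext (faceOf_arcPrev K x).symm⟩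
      · exact ⟨Sum.inr (Quot.mk _ (D.rotAt K x)), Subtype.ext (faceOf_sideNext K x).symm⟩
      · exact (hp ((surface_faceOf_mem_hole_iff K _).2 ⟨x, rfl⟩)).elim
  have hband : 2 * Nat.card Band = Nat.card (D.DartAt K) := by
    have h := two_mul_numClasses_involutive (f := b) (rotAt_four hK)
    have h0 : IsEmpty {x : D.DartAt K // b x = x} :=
      ⟨fun x => (atCrossing_of_mem hK x.1.2).rot_rot_ne (congrArg Subtype.val x.2)⟩
    rwa [Nat.card_of_isEmpty (α := {x : D.DartAt K // b x = x}), add_zero] at h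
  rw [← Nat.card_congr (Equiv.ofBijective f hf), Nat.card_sum, ← card_quotient_sameCycle, ← hband]
  ring

variable (K) in
/-- The region to the left of a dart of the diagram. -/
def regionLeft (x : D.Dart) : D.Region K :=
  GraphSurface.regionOf ⟨old x, faceOf_old_notMem_hole K x⟩

theorem regionLeft_facePerm (x : D.Dart) : D.regionLeft K (D.facePerm x) = D.regionLeft K x :=
  GraphSurface.regionOf_eq_of_faceOf (faceOf_old_facePerm K x)

theorem regionLeft_rev {x : D.Dart} (hx : x ∉ D.proj) :
    D.regionLeft K (D.rev x) = D.regionLeft K x :=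
  GraphSurface.regionOf_eq_of_rev (old_notMem_graph K hx) rfl

theorem regionOf_arcNext (x : D.DartAt K) :
    GraphSurface.regionOf (⟨arcNext x, faceOf_arcNext_notMem_hole K x⟩ : (D.surface K).AllSide) =
      D.regionLeft K x.1 := by
  have h : GraphSurface.regionOf (⟨arcPrev (D.rotAt K x), faceOf_arcPrev_notMem_hole K _⟩ :
      (D.surface K).AllSide) =
      GraphSurface.regionOf ⟨arcNext x, faceOf_arcNext_notMem_hole K x⟩ :=
    GraphSurface.regionOf_eq_of_rev (arcNext_notMem_graph K x) rfl
  refine h.symm.trans (GraphSurface.regionOf_eq_of_faceOf ((faceOf_arcPrev K _).trans ?_))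
  exact congrArg (fun z => (D.surface K).faceOf (old z)) (D.rot_inv_rot x.1)

theorem regionLeft_glue (hK : K ⊆ D.crossings) (x : D.Dart) :
    D.regionLeft K (D.glue K x) = D.regionLeft K x := by
  by_cases hx : x ∈ D.proj
  · by_cases h : D.vertexOf x ∈ K
    · rw [glue_of_mem hK h]
      refine ((regionOf_arcNext (D.rotAt K (D.rotAt K ⟨x, h⟩))).symm.trans ?_).trans
        (regionOf_arcNext ⟨x, h⟩)
      exact GraphSurface.regionOf_eq_of_faceOf (faceOf_arcNext_rot_rot K _)
    · rw [glue_of_vertexOf_notMem hx h]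
  · rw [glue_of_notMem hx, regionLeft_rev hx]

theorem regionLeft_surjective : Function.Surjective (D.regionLeft K) := by
  rintro ⟨⟨p, hp⟩⟩
  induction p using Quotient.ind with | _ s => ?_
  rcases s with x | x | x | x | x
  · exact ⟨x, rfl⟩
  · exact ⟨x.1, (regionOf_arcNext x).symm⟩
  · exact ⟨D.rot⁻¹ x.1, congrArg (Quot.mk _) (Subtype.ext (faceOf_arcPrev K x).symm)⟩
  · exact ⟨D.rot x.1, (regionOf_arcNext (D.rotAt K x)).symm.trans
      (congrArg (Quot.mk _) (Subtype.ext (faceOf_sideNext K x).symm))⟩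
  · exact (hp ((surface_faceOf_mem_hole_iff K _).2 ⟨x, rfl⟩)).elim

/-- Old faces alone represent all regions, since each band hangs on old faces at both ends; passing
through a band is what `glue` does at `K`. -/
theorem card_region (hK : K ⊆ D.crossings) :
    Nat.card (D.Region K) = numOrbits D.facePerm (gluePerm hK) := by
  let r : D.Dart → D.Dart → Prop := fun x y => y = D.facePerm x ∨ y = gluePerm hK x
  have rφ : ∀ x, Quot.mk r (D.facePerm x) = Quot.mk r x := fun x => quot_mk_eq_of_rel (Or.inl rfl)
  have rγ : ∀ x, Quot.mk r (D.glue K x) = Quot.mk r x := fun x => quot_mk_eq_of_rel (Or.inr rfl)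
  let c : D.SurgeryDart K → Option (Quot r) := fun s => match s with
    | old x => some (Quot.mk r x)
    | arcPrev x => some (Quot.mk r (D.rot⁻¹ x.1))
    | arcNext x => some (Quot.mk r x.1)
    | sideNext x => some (Quot.mk r (D.rot x.1))
    | sidePrev x => none
  have hc : ∀ s t : D.SurgeryDart K, (D.surface K).faceOf s = (D.surface K).faceOf t →
      c s = c t := by
    intro s t
    refine eq_of_surface_faceOf_eq K c (fun _ => rfl) (fun _ => rfl) (fun x => ?_) (fun _ => rfl)
      (fun x h => ?_) (fun x _ => ?_)
    · refine congrArg some (Eq.trans ?_ (rγ x.1))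
      rw [glue_of_mem hK x.2]; rfl
    · exact congrArg some (rφ x)
    · exact congrArg some (rφ x)
  let F : (D.surface K).Face → Option (Quot r) := Quotient.lift c fun s t h =>
    hc s t (Quotient.sound h)
  let G : D.Region K → Option (Quot r) := Quot.lift (fun p => F p.1) (by
    rintro p q ⟨s, hs, hp, hq⟩
    rw [← hp, ← hq]
    change c s = c (D.surgeryRev K s)
    rcases s with x | x | x | x | x
    · have hx : x ∉ D.proj := fun h => hs (Or.inl ⟨x, h, rfl⟩)
      refine congrArg some (Eq.trans (rγ x).symm ?_)
      rw [glue_of_notMem hx]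
    · exact congrArg (fun z => some (Quot.mk r z)) (D.rot_inv_rot x.1).symm
    · rfl
    · exact (hs (Or.inr (Or.inl ⟨x, rfl⟩))).elim
    · exact (hs (Or.inr (Or.inr ⟨x, rfl⟩))).elim)
  let f : Quot r → D.Region K := Quot.lift (D.regionLeft K) (by
    rintro x y (rfl | rfl)
    · exact (regionLeft_facePerm x).symm
    · exact (regionLeft_glue hK x).symm)
  have hGf : ∀ q, G (f q) = some q := by
    rintro ⟨x⟩; rfl
  refine (Nat.card_congr (Equiv.ofBijective f ⟨fun q q' h => ?_, fun R => ?_⟩)).symm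
  · exact Option.some.inj ((hGf q).symm.trans ((congrArg G h).trans (hGf q')))
  · obtain ⟨x, rfl⟩ := regionLeft_surjective R
    exact ⟨Quot.mk r x, rfl⟩

/-- A region without sides on the graph would, by connectedness of the sphere, contain all old
darts, including those of the projection. -/
theorem exists_side_mem_graph (hne : D.proj.Nonempty) (R : (D.surface K).Region) :
    ∃ x : GraphSurface.Side R, x.1 ∈ (D.surface K).graph := by
  by_contra! h
  obtain ⟨x, hx⟩ := regionLeft_surjective (K := K) R
  have hP : ∀ y, D.regionLeft K y = R → y ∉ D.proj := fun y hy hyP =>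
    h ⟨old y, faceOf_old_notMem_hole K y, hy⟩ (Or.inl ⟨y, hyP, rfl⟩)
  have hrev' : ∀ y, D.regionLeft K y = R → D.regionLeft K (D.rev y) = R := fun y hy => by
    rw [regionLeft_rev (hP y hy), hy]
  have hrev : ∀ y, D.regionLeft K (D.rev y) = R ↔ D.regionLeft K y = R := fun y =>
    ⟨fun hy => by simpa [D.rev_rev] using hrev' _ hy, hrev' y⟩
  obtain ⟨y, hy⟩ := hne
  refine hP y (D.isSphere.1.induction (p := fun z => D.regionLeft K z = R) (fun z => ?_) hrev
    hx y) hy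
  rw [← hrev, ← regionLeft_facePerm, D.facePerm_rev, D.rot_inv_rot]

/-- The fixed points of the involution are the darts of the projection that are not at `K`. -/
theorem two_mul_numCycles_gluePerm (hK : K ⊆ D.crossings) :
    2 * numCycles (gluePerm hK) + Nat.card (D.DartAt K) =
      Nat.card D.Dart + Nat.card D.proj := by
  have h := two_mul_numClasses_involutive (glue_involutive hK)
  let f : {x // D.glue K x = x} ⊕ D.DartAt K → D.proj := Sum.elim
    (fun x => ⟨x.1, by
      by_contra hx
      have := x.2
      rw [glue_of_notMem hx] at this
      exact D.rev_ne _ this⟩)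
    (fun x => ⟨x.1, (atCrossing_of_mem hK x.2).1⟩)
  have hfix : ∀ x, D.glue K x = x → D.vertexOf x ∉ K := by
    intro x hx hxK
    rw [glue_of_mem hK hxK] at hx
    exact (atCrossing_of_mem hK hxK).rot_rot_ne hx
  have hf : Function.Bijective f := by
    constructor
    · rintro (⟨x, hx⟩ | ⟨x, hx⟩) (⟨y, hy⟩ | ⟨y, hy⟩) h <;>
        obtain rfl : x = y := congrArg Subtype.val h
      · rfl
      · exact (hfix x hx hy).elim
      · exact (hfix x hy hx).elim
      · rfl
    · rintro ⟨x, hx⟩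
      by_cases h : D.vertexOf x ∈ K
      · exact ⟨Sum.inr ⟨x, h⟩, rfl⟩
      · exact ⟨Sum.inl ⟨x, glue_of_vertexOf_notMem hx h⟩, rfl⟩
  rw [← Nat.card_congr (Equiv.ofBijective f hf), Nat.card_sum]
  change 2 * numCycles (gluePerm hK) = _ at h
  omega

end Counting

end LinkDiagram

end

theorem mainTheorem6 (D : LinkDiagram.{u}) (hne : D.proj.Nonempty) (k : ℕ)
    (hD : D.IsAlmostAlternating k)
    (K : Set D.Vertex) (hK : D.IsDealternatorSet K) (hk : K.ncard = k) :
    Nat.card D.CircleA + Nat.card D.CircleB =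
      Nat.card (D.Region K) + ∑ᶠ R : D.Region K, GraphSurface.h1Rank R := by
  have : Nonempty D.Dart := ⟨hne.some⟩
  have e1 := LinkDiagram.card_circles hK
  have e2 := LinkDiagram.numCycles_facePerm_mul_gluePerm hK.1
  have e3 := LinkDiagram.twiceGenus_gluePerm hK.1
  have e4 := LinkDiagram.card_region hK.1
  have e5 := GraphSurface.sum_h1Rank (S := D.surface K)
    (fun _ hs => LinkDiagram.surface_faceOf_notMem_hole K hs)
    (LinkDiagram.exists_side_mem_graph hne)
  have e6 := LinkDiagram.card_allSide_surface (D := D) (K := K)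
  have e7 := LinkDiagram.card_allCorner_surface hK.1
  have e8 := LinkDiagram.card_polygon_surface hK.1
  have e9 := LinkDiagram.card_notMem_graph_surface (D := D) (K := K)
  have e10 := LinkDiagram.two_mul_numCycles_gluePerm hK.1
  rw [twiceGenus] at e3
  change Nat.card (D.surface K).Region = _ at e4
  change _ = Nat.card (D.surface K).Region +
    ∑ᶠ R : (D.surface K).Region, GraphSurface.h1Rank R
  -- With n, p, d the numbers of darts, of projection darts and of darts at `K`, F the faces and v
  -- the vertices off the projection, genus zero gives 2b = n + 4r − 2F − p + d − 2v, while the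
  -- homology count gives 2s = n + 2r − 2F − p + d − 2v.
  omega
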